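/- Let $k$ be a field, $d\ge 2$, $R=k[x_1,\dots,x_d]$, and let $I\subset R$ be a monomial ideal with $\dim(R/I)=0$, minimally generated by the monomials $x^{v_1},\dots,x^{v_q}$, where $v_j\in\mathbb{N}^d$. For each $i=1,\dots,d$ exactly one of these generators is a power of $x_i$, say $x_i^{a_i}$, and $a_i\ge 1$. Put $\alpha_0=(1/a_1,\dots,1/a_d)$ and let $e_i$ be the $i$-th unit vector. Consider in $\mathbb{Q}^d$ the lattice polytopes $$S=\mathrm{conv}(0,a_1e_1,\dots,a_de_d),\qquad P=\mathrm{conv}\bigl(\{a_1e_1,\dots,a_de_d\}\cup\{v_j : \langle v_j,\alpha_0\rangle<1\}\bigr).$$ For a lattice polytope $T\subset\mathbb{Q}^d$ let $E_T\in\mathbb{Q}[x]$ be its Ehrhart polynomial, i.e. the unique polynomial with $E_T(n)=|\mathbb{Z}^d\cap nT|$ for all sufficiently large $n\in\mathbb{N}$. Let $\overline{J}$ denote the integral closure of an ideal $J$, and let $f(n)=\ell_R(R/\overline{I^n})$ be the length of the $R$-module $R/\overline{I^n}$, for $n\in\mathbb{N}=\{0,1,2,\dots\}$ (so $f(0)=0$).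 Then $E_S$ and $E_P$ exist, $f(n)$ is finite for all $n\in\mathbb{N}$, and $$f(n)=E_S(n)-E_P(n)\quad\text{for all } n\in\mathbb{N}.$$ In particular there are $c_0,\dots,c_d\in\mathbb{Q}$ with $c_d\neq 0$ and $c_0=0$ such that $f(n)=c_dn^d+c_{d-1}n^{d-1}+\cdots+c_1n+c_0$ for all $n\in\mathbb{N}$. -/

import Mathlib

namespace MonomialIdeal

section IntegralClosure

variable {R : Type*} [CommRing R]

/-- `x` is integral over the ideal `J`: it satisfies an equation
`x ^ m + c₁ * x ^ (m - 1) + ⋯ + c_m = 0` with `c_i ∈ J ^ i` for all `i`. Here the equation is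
recorded by a monic polynomial `p` of degree `m` whose coefficient at `X ^ j` is `c_{m - j}`. -/
def IsIntegralOverIdeal (J : Ideal R) (x : R) : Prop :=
  ∃ p : Polynomial R, p.Monic ∧ p.eval x = 0 ∧ ∀ j, p.coeff j ∈ J ^ (p.natDegree - j)

/-- The Rees algebra `R[Jt]`, as the subalgebra of `R[t]` generated by the `r t` with `r ∈ J`. -/
noncomputable def rees (J : Ideal R) : Subalgebra R (Polynomial R) :=
  Algebra.adjoin R {f | ∃ r ∈ J, Polynomial.C r * Polynomial.X = f}

theorem monomial_mem_rees {J : Ideal R} {n : ℕ} {r : R} (hr : r ∈ J ^ n) :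
    Polynomial.monomial n r ∈ rees J := by
  have h : rees J = reesAlgebra J := by
    rw [rees, ← adjoin_monomial_eq_reesAlgebra]
    congr 1
    ext f
    simp [Polynomial.C_mul_X_eq_monomial]
  rw [h]
  exact reesAlgebra.monomial_mem.mpr hr

/-- `x` is integral over `J` if and only if `x t` is integral over the Rees algebra `R[Jt]`. -/
theorem isIntegralOverIdeal_iff (J : Ideal R) (x : R) :
    IsIntegralOverIdeal J x ↔ IsIntegral (rees J) (Polynomial.C x * Polynomial.X) := by
  constructor
  · rintro ⟨p, hp, hx, hc⟩
    cases subsingleton_or_nontrivial R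
    · rw [Subsingleton.elim (Polynomial.C x * Polynomial.X) 0]
      exact isIntegral_zero
    let c : ℕ → rees J := fun j =>
      ⟨Polynomial.monomial (p.natDegree - j) (p.coeff j), monomial_mem_rees (hc j)⟩
    let q : Polynomial (rees J) := ∑ j ∈ Finset.range p.natDegree, Polynomial.monomial j (c j)
    refine ⟨Polynomial.X ^ p.natDegree + q, Polynomial.monic_X_pow_add ?_, ?_⟩
    · refine (Polynomial.degree_sum_le _ _).trans_lt ?_
      refine (Finset.sup_lt_iff (WithBot.bot_lt_coe _)).mpr fun j hj => ?_
      refine (Polynomial.degree_monomial_le _ _).trans_lt ?_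
      exact_mod_cast Finset.mem_range.mp hj
    · have e : ∀ j ∈ Finset.range p.natDegree,
          Polynomial.eval₂ (algebraMap (rees J) (Polynomial R)) (Polynomial.C x * Polynomial.X)
            (Polynomial.monomial j (c j)) =
          Polynomial.C (p.coeff j * x ^ j) * Polynomial.X ^ p.natDegree := by
        intro j hj
        have hj' : p.natDegree - j + j = p.natDegree :=
          Nat.sub_add_cancel (Finset.mem_range.mp hj).le
        rw [Polynomial.eval₂_monomial]
        change Polynomial.monomial (p.natDegree - j) (p.coeff j) * _ = _
        rw [← Polynomial.C_mul_X_pow_eq_monomial, mul_pow, ← hj', pow_add, Polynomial.C_mul,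
          Polynomial.C_pow, hj']
        ring
      rw [Polynomial.eval₂_add, Polynomial.eval₂_X_pow, Polynomial.eval₂_finsetSum,
        Finset.sum_congr rfl e, ← Finset.sum_mul, mul_pow, ← Polynomial.C_pow, ← add_mul,
        ← map_sum, ← Polynomial.C_add]
      have h0 : x ^ p.natDegree + ∑ j ∈ Finset.range p.natDegree, p.coeff j * x ^ j = 0 := by
        rw [Polynomial.eval_eq_sum_range, Finset.sum_range_succ, hp.coeff_natDegree, one_mul] at hx
        rw [add_comm, hx]
      rw [h0]
      simp
  · intro h
    obtain ⟨p, hp, hx, hc⟩ :=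
      Polynomial.exists_monic_aeval_eq_zero_forall_mem_pow_of_isIntegral (S := R) (I := J) (x := x)
        (by
          obtain ⟨g, hg, hgx⟩ := h
          refine ⟨g, hg, ?_⟩
          rw [← hgx]
          congr 1
          ext f : 1
          exact Polynomial.map_id)
    exact ⟨p, hp, by simpa using hx, hc⟩

/-- The integral closure of the ideal `J`, that is, the ideal of all elements of `R` that are
integral over `J`. -/
noncomputable def idealClosure (J : Ideal R) : Ideal R where
  carrier := {x | IsIntegralOverIdeal J x}
  zero_mem' := by
    change IsIntegralOverIdeal J 0
    rw [isIntegralOverIdeal_iff]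
    simpa using isIntegral_zero
  add_mem' := by
    intro x y hx hy
    change IsIntegralOverIdeal J (x + y)
    rw [isIntegralOverIdeal_iff, Polynomial.C_add, add_mul]
    exact ((isIntegralOverIdeal_iff J x).mp hx).add ((isIntegralOverIdeal_iff J y).mp hy)
  smul_mem' := by
    intro r x hx
    change IsIntegralOverIdeal J (r • x)
    rw [isIntegralOverIdeal_iff, smul_eq_mul, Polynomial.C_mul, mul_assoc]
    refine IsIntegral.mul ?_ ((isIntegralOverIdeal_iff J x).mp hx)
    exact isIntegral_algebraMap (R := rees J) (A := Polynomial R)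
      (x := ⟨Polynomial.C r, (rees J).algebraMap_mem r⟩)

/-- The Hilbert function `n ↦ ℓ_R (R / closure of I ^ n)`, with values in `ℕ∞`. -/
noncomputable def hilbertFunction (I : Ideal R) (n : ℕ) : ℕ∞ :=
  Module.length R (R ⧸ idealClosure (I ^ n))

end IntegralClosure

section Polytopes

open scoped Pointwise

variable {d : ℕ}

/-- The Ehrhart function `n ↦ |ℤ^d ∩ nP|` of a bounded subset `P` of `ℚ^d`. -/
noncomputable def ehrhartFunction (P : Set (Fin d → ℚ)) (n : ℕ) : ℕ :=
  Set.ncard {z : Fin d → ℤ | (fun i => (z i : ℚ)) ∈ (n : ℚ) • P}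

/-- `E` is the Ehrhart polynomial of `P`: the (unique) polynomial with rational coefficients
that agrees with the Ehrhart function of `P` at all large `n`. -/
def IsEhrhartPolynomial (P : Set (Fin d → ℚ)) (E : Polynomial ℚ) : Prop :=
  ∀ᶠ n : ℕ in Filter.atTop, (ehrhartFunction P n : ℚ) = E.eval (n : ℚ)

/-- The exponent vector `u ∈ ℕ^d` viewed as a point of `ℚ^d`. -/
def toPoint (u : Fin d →₀ ℕ) : Fin d → ℚ := fun i => (u i : ℚ)

/-- The simplex `S = conv (0, a₁ e₁, …, a_d e_d)`. -/
def simplexS (a : Fin d → ℕ) : Set (Fin d → ℚ) :=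
  convexHull ℚ (insert 0 (Set.range fun i => toPoint (Finsupp.single i (a i))))

/-- The polytope `P`: the convex hull of those `v_j` that are one of the `a_i e_i` or satisfy
`⟨v_j, α₀⟩ < 1`, where `α₀ = (1 / a₁, …, 1 / a_d)`. -/
def polytopeP (a : Fin d → ℕ) {q : ℕ} (v : Fin q → Fin d →₀ ℕ) : Set (Fin d → ℚ) :=
  convexHull ℚ {w | ∃ j, w = toPoint (v j) ∧
    ((∃ i, v j = Finsupp.single i (a i)) ∨ ∑ i, (v j i : ℚ) * (1 / (a i : ℚ)) < 1)}

end Polytopes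

/-- The ideal `I` of `k[x₁, …, x_d]` is minimally generated by the monomials `x ^ (v j)`: they
generate `I`, and none of them lies in the ideal generated by the others. -/
def IsMinimallyGeneratedBy {k : Type*} [Field k] {d q : ℕ} (I : Ideal (MvPolynomial (Fin d) k))
    (v : Fin q → Fin d →₀ ℕ) : Prop :=
  I = Ideal.span (Set.range fun j => MvPolynomial.monomial (v j) (1 : k)) ∧
  ∀ j, MvPolynomial.monomial (v j) (1 : k) ∉
    Ideal.span ((fun l => MvPolynomial.monomial (v l) (1 : k)) '' {l | l ≠ j})

end MonomialIdeal

/-! The integral closure of `I ^ n` is spanned by the monomials whose exponents lie in the `n`-th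
dilate of the Newton polyhedron of the generators, so `f n` counts the exponents outside it. All of
these lie in `nS`, and the part of `nS` inside the dilated polyhedron is exactly `nP`
(`mem_smul_polytopeP`). Hence `f n` is the difference of two lattice point counts for `n ≥ 1`. At `n
= 0` the equality persists because `f 0 = 0` and both Ehrhart polynomials have constant term `1`.

One inclusion for the closure clears denominators. For the other, if an integral `p` has an exponent
outside the polyhedron, there is a convex set `L` containing the polyhedron and all exponents of
`p`, with such an exponent `u` as an extreme point not in the polyhedron. In an integral equation of
degree `m` the monomial `m • u` then occurs only in `p ^ m`, a contradiction.

The Ehrhart polynomial comes from a triangulation in algebraic guise: among all nonnegative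
combinations of the vertices giving a point, take the lexicographically largest. The supports that
occur form a simplicial complex. Splitting off integer parts of the coefficients writes the count as
a finite sum of binomial polynomials. Its value at `0` is the Euler characteristic of the complex,
which is `1` because the complex is a cone over the first vertex. -/

namespace MonomialIdeal

/-! ### Lexicographically maximal representations -/

section LexMax

set_option linter.unusedSectionVars false

variable {ι : Type*} [Fintype ι] [LinearOrder ι] {E : Type*} [AddCommGroup E] [Module ℚ E]
  {A : (ι → ℚ) →ₗ[ℚ] E}

/-- `x` is the lexicographically largest nonnegative vector in its fibre under `A`. -/
def IsLexMax (A : (ι → ℚ) →ₗ[ℚ] E) (x : ι → ℚ) : Prop :=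
  0 ≤ x ∧ ∀ y, 0 ≤ y → A y = A x → toLex y ≤ toLex x

theorem IsLexMax.eq_of_map_eq {x y : ι → ℚ} (hx : IsLexMax A x) (hy : IsLexMax A y)
    (h : A x = A y) : x = y :=
  toLex.injective (le_antisymm (hy.2 x hx.1 h) (hx.2 y hy.1 h.symm))

theorem toLex_lt_add_smul_sub {x y z : ι → ℚ} {t : ℚ} (ht : 0 < t) (h : toLex y < toLex z) :
    toLex x < toLex (x + t • (z - y)) := by
  obtain ⟨i, hi, hlt⟩ := h
  refine ⟨i, fun j hj => ?_, ?_⟩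
  · have := hi j hj
    simp only [Pi.toLex_apply] at this ⊢
    simp [this]
  · simp only [Pi.toLex_apply] at hlt ⊢
    simp only [Pi.add_apply, Pi.smul_apply, Pi.sub_apply, smul_eq_mul, lt_add_iff_pos_right]
    exact mul_pos ht (sub_pos.mpr hlt)

theorem exists_pos_smul_le {x y : ι → ℚ} (hx : 0 ≤ x) (hy : 0 ≤ y)
    (h : ∀ i, x i = 0 → y i = 0) : ∃ t : ℚ, 0 < t ∧ t • y ≤ x := by
  have hs : 0 ≤ ∑ i, y i / x i := Finset.sum_nonneg fun i _ => div_nonneg (hy i) (hx i)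
  -- Division by zero yields `0`, so coordinates outside the support of `x` contribute nothing; the
  -- summand `1` keeps the denominator positive.
  refine ⟨1 / (1 + ∑ i, y i / x i), by positivity, fun i => ?_⟩
  simp only [Pi.smul_apply, smul_eq_mul]
  rw [one_div, inv_mul_le_iff₀ (by positivity)]
  rcases eq_or_ne (x i) 0 with h0 | h0
  · simp [h0, h i h0]
  · have h1 : y i / x i ≤ ∑ i, y i / x i :=
      Finset.single_le_sum (f := fun i => y i / x i) (fun j _ => div_nonneg (hy j) (hx j))
        (Finset.mem_univ i)
    have hpos : 0 < x i := lt_of_le_of_ne (hx i) (Ne.symm h0)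
    rw [div_le_iff₀ hpos] at h1
    linarith

/-- A small multiple `t • y` fits below `x`, so an improvement `z` of `y` would give the improvement
`x + t • (z - y)` of `x`. Thus maximality depends only on the support and passes to smaller
supports: the supports form a simplicial complex. -/
theorem IsLexMax.of_support_subset {x y : ι → ℚ} (hx : IsLexMax A x) (hy : 0 ≤ y)
    (h : ∀ i, x i = 0 → y i = 0) : IsLexMax A y := by
  refine ⟨hy, fun z hz hzy => ?_⟩
  by_contra hlt
  obtain ⟨t, ht, hle⟩ := exists_pos_smul_le hx.1 hy h
  refine absurd (hx.2 (x + t • (z - y)) ?_ ?_) (not_le.mpr (toLex_lt_add_smul_sub ht (not_le.mp hlt)))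
  · intro i
    have h1 := hle i
    have h2 := mul_nonneg ht.le (hz i)
    simp only [Pi.smul_apply, smul_eq_mul, Pi.add_apply, Pi.sub_apply, Pi.zero_apply] at *
    linarith
  · simp [hzy]

/-- A lexicographically larger competitor has at least as large a first coordinate, so `t` can be
subtracted there without losing nonnegativity, which would beat `x`. This makes the complex of
supports a cone with apex `b`. -/
theorem IsLexMax.add_single {b : ι} (hb : ∀ i, b ≤ i) {x : ι → ℚ} (hx : IsLexMax A x) {t : ℚ}
    (ht : 0 ≤ t) : IsLexMax A (x + Pi.single b t) := by
  refine ⟨add_nonneg hx.1 (Pi.single_nonneg.mpr ht), fun y hy hyx => ?_⟩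
  by_contra hlt
  rw [not_le] at hlt
  have hbb := Pi.apply_le_of_toLex (i := b) hlt.le fun j hj => absurd (hb j) (not_le.mpr hj)
  have h0 : 0 ≤ y - Pi.single b t := by
    intro i
    rcases eq_or_ne i b with rfl | hi
    · have := hx.1 i
      simp only [Pi.add_apply, Pi.single_eq_same, Pi.zero_apply, Pi.sub_apply] at *
      linarith
    · simpa [hi] using hy i
  refine absurd (hx.2 _ h0 (by simp [hyx])) (not_le.mpr ?_)
  have := toLex_lt_add_smul_sub (x := x) one_pos hlt
  rwa [show x + (1 : ℚ) • (y - (x + Pi.single b t)) = y - Pi.single b t by rw [one_smul]; abel]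
    at this

/-- The restriction of `A` to the vectors supported on the support of `x` is injective. -/
def IndepSupport (A : (ι → ℚ) →ₗ[ℚ] E) (x : ι → ℚ) : Prop :=
  ∀ c, (∀ i, x i = 0 → c i = 0) → A c = 0 → c = 0

/-- Carathéodory reduction: a kernel vector on the support, with sign chosen to increase the
lexicographic order, is followed until a coordinate vanishes. -/
theorem exists_indepSupport_ge (hA : ∀ c, A c = 0 → ∑ i, c i = 0) (x : ι → ℚ) (hx : 0 ≤ x) :
    ∃ y, 0 ≤ y ∧ A y = A x ∧ toLex x ≤ toLex y ∧ IndepSupport A y := by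
  induction hn : (Finset.univ.filter fun i => x i ≠ 0).card using Nat.strong_induction_on
    generalizing x with
  | _ n ih =>
  by_cases hI : IndepSupport A x
  · exact ⟨x, hx, rfl, le_rfl, hI⟩
  have : ∃ c, (∀ i, x i = 0 → c i = 0) ∧ A c = 0 ∧ toLex 0 < toLex c := by
    simp only [IndepSupport, not_forall] at hI
    obtain ⟨c, h1, h2, h3⟩ := hI
    rcases lt_or_gt_of_ne (fun h => h3 (toLex.injective h) : toLex c ≠ toLex 0) with h | h
    · refine ⟨-c, fun i hi => by simp [h1 i hi], by simp [h2], ?_⟩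
      simpa using toLex_lt_add_smul_sub (x := 0) one_pos h
    · exact ⟨c, h1, h2, h⟩
  obtain ⟨c, h1, h2, h3⟩ := this
  -- The coordinates of `c` sum to zero and `c` is nonzero, so the move must eventually leave the
  -- orthant.
  have hne : (Finset.univ.filter fun i => c i < 0).Nonempty := by
    by_contra hcon
    have hc : ∀ i ∈ Finset.univ, 0 ≤ c i := by
      simpa [Finset.filter_eq_empty_iff, Finset.not_nonempty_iff_eq_empty] using hcon
    have := (Finset.sum_eq_zero_iff_of_nonneg hc).mp (hA c h2)
    have hc0 : c = 0 := funext fun i => this i (Finset.mem_univ i)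
    rw [hc0] at h3
    exact lt_irrefl _ h3
  obtain ⟨i₀, hi₀, hmin⟩ := Finset.exists_min_image _ (fun i => x i / (- c i)) hne
  simp only [Finset.mem_filter, Finset.mem_univ, true_and] at hi₀ hmin
  have hxi₀ : 0 < x i₀ := lt_of_le_of_ne (hx i₀) fun h => hi₀.ne (h1 i₀ h.symm)
  set t := x i₀ / (- c i₀) with ht
  have htpos : 0 < t := div_pos hxi₀ (neg_pos.mpr hi₀)
  have hnn : 0 ≤ x + t • (c - 0) := by
    intro i
    simp only [Pi.zero_apply, sub_zero, Pi.add_apply, Pi.smul_apply, smul_eq_mul]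
    rcases lt_or_ge (c i) 0 with h | h
    · have := hmin i h
      rw [le_div_iff₀ (by linarith)] at this
      linarith
    · exact add_nonneg (hx i) (mul_nonneg htpos.le h)
  have hlt := toLex_lt_add_smul_sub (x := x) htpos h3
  obtain ⟨y, hy0, hy1, hy2, hy3⟩ := ih _ (by
    rw [← hn]
    refine Finset.card_lt_card ⟨?_, ?_⟩
    · intro i
      simp only [Finset.mem_filter, Finset.mem_univ, true_and]
      intro h h0
      simp [h0, h1 i h0] at h
    · intro hsub
      have := hsub (Finset.mem_filter.mpr ⟨Finset.mem_univ i₀, hxi₀.ne'⟩)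
      simp only [Finset.mem_filter, Finset.mem_univ, true_and] at this
      apply this
      simp only [sub_zero, Pi.add_apply, Pi.smul_apply, smul_eq_mul, ht]
      have := hi₀.ne
      field_simp
      ring) _ hnn rfl
  exact ⟨y, hy0, by rw [hy1]; simp [h2], hlt.le.trans hy2, hy3⟩

/-- In one fibre a vector with independent support is determined by that support, so there are
finitely many, and every nonnegative vector of the fibre is dominated by one of them. -/
theorem exists_isLexMax (hA : ∀ c, A c = 0 → ∑ i, c i = 0) (x : ι → ℚ) (hx : 0 ≤ x) :
    ∃ y, IsLexMax A y ∧ A y = A x := by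
  let S : Set (ι → ℚ) := {y | 0 ≤ y ∧ A y = A x ∧ IndepSupport A y}
  have hS : S.Finite := by
    refine Set.Finite.of_finite_image (f := fun y => {i | y i ≠ 0}) (Set.toFinite _) ?_
    intro y hy z hz hyz
    have hyz' : ∀ i, y i = 0 ↔ z i = 0 := fun i => not_iff_not.mp (Set.ext_iff.mp hyz i)
    refine sub_eq_zero.mp (hy.2.2 (y - z) (fun i hi => ?_) ?_)
    · simp [hi, (hyz' i).mp hi]
    · rw [map_sub, hy.2.1, hz.2.1, sub_self]
  obtain ⟨y₀, h0, h1, -, h3⟩ := exists_indepSupport_ge hA x hx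
  obtain ⟨y, hy, hmax⟩ := Set.exists_max_image S toLex hS ⟨y₀, h0, h1, h3⟩
  refine ⟨y, ⟨hy.1, fun z hz hzy => ?_⟩, hy.2.1⟩
  obtain ⟨w, hw0, hw1, hw2, hw3⟩ := exists_indepSupport_ge hA z hz
  exact hw2.trans (hmax w ⟨hw0, by rw [hw1, hzy, hy.2.1], hw3⟩)

end LexMax

end MonomialIdeal

namespace MonomialIdeal

/-! ### Counting maximal vectors by a polynomial -/

section Counting

open Polynomial

/-- For `1 ≤ n < h ≤ s` the factors run from `n - h + 1 ≤ 0` to `n - h + s - 1 ≥ 0`, so one of them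
is zero. The polynomial thus agrees with the truncated binomial count from `n = 1` on. -/
theorem eval_preHilbertPoly_natCast {s h n : ℕ} (hs : 1 ≤ s) (hh : h ≤ s) (hn : 1 ≤ n) :
    (preHilbertPoly ℚ (s - 1) h).eval (n : ℚ) =
      if h ≤ n then ((s + (n - h) - 1).choose (n - h) : ℚ) else 0 := by
  split_ifs with hle
  · rw [preHilbertPoly_eq_choose_sub_add _ _ hle, show s + (n - h) - 1 = n - h + (s - 1) by omega,
      Nat.choose_symm_add]
  · have := ascPochhammer_eval_neg_coe_nat_of_lt (R := ℚ) (n := s - 1) (k := h - n - 1) (by omega)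
    rw [show (-((h - n - 1 : ℕ) : ℚ)) = n - h + 1 by
      rw [Nat.cast_sub (by omega), Nat.cast_sub (by omega)]; push_cast; ring] at this
    simp [preHilbertPoly, this]

/-- The factors run from `1 - h` to `s - 1 - h`; they avoid zero only if `h = s`, when their product
is `(-1) ^ (s - 1) * (s - 1)!`. -/
theorem eval_zero_preHilbertPoly {s h : ℕ} (hh : 1 ≤ h) (hs : h ≤ s) :
    (preHilbertPoly ℚ (s - 1) h).eval 0 = if h = s then (-1) ^ (s - 1) else 0 := by
  have e : (preHilbertPoly ℚ (s - 1) h).eval 0 =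
      ((s - 1).factorial : ℚ)⁻¹ * (ascPochhammer ℚ (s - 1)).eval (-((h - 1 : ℕ) : ℚ)) := by
    rw [Nat.cast_sub hh]
    simp only [preHilbertPoly, eval_smul, eval_comp, smul_eq_mul]
    congr 2
    simp
    ring
  rw [e]
  split_ifs with hle
  · subst hle
    rw [ascPochhammer_eval_neg_eq_descPochhammer, descPochhammer_eval_eq_descFactorial,
      Nat.descFactorial_self]
    have : ((h - 1).factorial : ℚ) ≠ 0 := by positivity
    field_simp
  · rw [ascPochhammer_eval_neg_coe_nat_of_lt (by omega), mul_zero]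

variable {ι : Type*} [Fintype ι] [LinearOrder ι] {E : Type*} [AddCommGroup E] [Module ℚ E]
  {A : (ι → ℚ) →ₗ[ℚ] E}

theorem isLexMax_zero (hA : ∀ c, A c = 0 → ∑ i, c i = 0) : IsLexMax A 0 := by
  refine ⟨le_rfl, fun y hy h => ?_⟩
  have := (Finset.sum_eq_zero_iff_of_nonneg fun i _ => hy i).mp (hA y (by simpa using h))
  rw [show y = 0 from funext fun i => this i (Finset.mem_univ i)]

/-- The `0`-`1` vector with support `s`. -/
def indicatorVec (s : Finset ι) : ι → ℚ := fun i => if i ∈ s then 1 else 0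

/-- The supports of lexicographically maximal vectors form a cone with apex the first index, so
that their Euler characteristic vanishes. -/
theorem sum_neg_one_pow_card_isLexMax {b : ι} (hb : ∀ i, b ≤ i) (D : Finset (Finset ι))
    (hD : ∀ s, s ∈ D ↔ IsLexMax A (indicatorVec s)) : ∑ s ∈ D, (-1 : ℚ) ^ s.card = 0 := by
  refine Finset.sum_involution (fun s _ => symmDiff s {b}) ?_ ?_ ?_ ?_
  · intro s _
    by_cases h : b ∈ s
    · have e : symmDiff s {b} = s.erase b := by
        ext i; simp only [Finset.mem_symmDiff, Finset.mem_singleton, Finset.mem_erase]; grind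
      have := Finset.card_erase_add_one h
      rw [e, ← this, pow_succ]; ring
    · have e : symmDiff s {b} = insert b s := by
        ext i; simp only [Finset.mem_symmDiff, Finset.mem_singleton, Finset.mem_insert]; grind
      rw [e, Finset.card_insert_of_notMem h, pow_succ]; ring
  · intro s _ _ h
    have := congrArg (b ∈ ·) h
    simp [Finset.mem_symmDiff] at this
  · intro s hs
    rw [hD] at hs ⊢
    -- Toggling `b` stays inside the support of `s` enlarged by the apex.
    refine (hs.add_single hb zero_le_one).of_support_subset ?_ ?_
    · intro i
      simp only [indicatorVec, Pi.zero_apply]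
      split_ifs <;> norm_num
    · intro i
      rcases eq_or_ne i b with rfl | hi
      · simp only [indicatorVec, Pi.add_apply, Pi.single_eq_same]
        split_ifs <;> norm_num
      · simp [indicatorVec, Finset.mem_symmDiff, hi]
  · intro s _
    simp

theorem ceil_add_nat_sub_one {r : ℚ} (h0 : 0 ≤ r) (h1 : r ≤ 1) {m : ℕ} (hm : r = 0 → m = 0) :
    ⌈r + m⌉₊ - 1 = m := by
  rcases eq_or_lt_of_le h0 with h | h
  · simp [← h, hm h.symm]
  · rw [Nat.ceil_add_natCast h0, show ⌈r⌉₊ = 1 by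
      rw [Nat.ceil_eq_iff one_ne_zero]; simpa using ⟨h, h1⟩]
    simp

-- Each vector counted is uniquely `r + m`, with `m` a natural vector on the support of `r` and `r`
-- having coordinates in `(0, 1]` there. The finitely many `r` contribute binomials in `n - ht r`.
-- At `0` only those with height equal to support size survive, that is, the indicator vectors of
-- nonempty faces, with alternating signs.
open Classical in
theorem exists_polynomial_ncard_isLexMax {b : ι} (hb : ∀ i, b ≤ i) (Λ : AddSubgroup E)
    (hAΛ : ∀ i, A (Pi.single i 1) ∈ Λ) (hA : ∀ c, A c = 0 → ∑ i, c i = 0)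
    (hint : ∀ c, A c ∈ Λ → ∃ z : ℤ, ∑ i, c i = z)
    (hfin : {e | e ∈ Λ ∧ ∃ r, 0 ≤ r ∧ r ≤ 1 ∧ A r = e}.Finite) :
    ∃ P : ℚ[X], P.eval 0 = 1 ∧ ∀ n : ℕ, 1 ≤ n →
      (Set.ncard {x | IsLexMax A x ∧ A x ∈ Λ ∧ ∑ i, x i = n} : ℚ) = P.eval (n : ℚ) := by
  have hAnat : ∀ m : ι → ℕ, A (fun i => (m i : ℚ)) ∈ Λ := by
    intro m
    have : (fun i => (m i : ℚ)) = ∑ i, m i • Pi.single i (1 : ℚ) := by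
      ext j
      simp [Finset.sum_apply, Pi.single_apply]
    rw [this, map_sum]
    exact Λ.sum_mem fun i _ => by rw [map_nsmul]; exact Λ.nsmul_mem (hAΛ i) _
  -- `A` is injective on maximal vectors, so it suffices that the images are finitely many.
  have hboxfin : {r | IsLexMax A r ∧ A r ∈ Λ ∧ r ≤ 1}.Finite := by
    refine Set.Finite.of_finite_image (f := A) (hfin.subset ?_) ?_
    · rintro _ ⟨r, ⟨h1, h2, h3⟩, rfl⟩
      exact ⟨h2, r, h1.1, h3, rfl⟩
    · intro x hx y hy h
      exact hx.1.eq_of_map_eq hy.1 h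
  let Box := hboxfin.toFinset
  have hBox : ∀ r, r ∈ Box ↔ IsLexMax A r ∧ A r ∈ Λ ∧ r ≤ 1 := fun r => by simp [Box]
  let ht : (ι → ℚ) → ℕ := fun r => ⌊∑ i, r i⌋₊
  let sp : (ι → ℚ) → Finset ι := fun r => Finset.univ.filter fun i => r i ≠ 0
  have hht : ∀ r ∈ Box, (ht r : ℚ) = ∑ i, r i := by
    intro r hr
    obtain ⟨h1, h2, -⟩ := (hBox r).mp hr
    obtain ⟨z, hz⟩ := hint r h2
    have hz0 : 0 ≤ z := by
      have : (0 : ℚ) ≤ z := hz ▸ Finset.sum_nonneg fun i _ => h1.1 i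
      exact_mod_cast this
    lift z to ℕ using hz0
    simp only [ht, hz]
    simp
  have hsum_sp : ∀ r : ι → ℚ, ∑ i, r i = ∑ i ∈ sp r, r i := by
    intro r
    rw [Finset.sum_filter_ne_zero]
  have hht_le : ∀ r ∈ Box, ht r ≤ (sp r).card := by
    intro r hr
    have : (ht r : ℚ) ≤ (sp r).card := by
      rw [hht r hr, hsum_sp r, ← nsmul_one]
      exact Finset.sum_le_card_nsmul _ _ _ fun i _ => ((hBox r).mp hr).2.2 i
    exact_mod_cast this
  have hht_pos : ∀ r ∈ Box, r ≠ 0 → 1 ≤ ht r := by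
    intro r hr hr0
    by_contra hcon
    have h0 : ∑ i, r i = 0 := by rw [← hht r hr]; norm_cast; omega
    have := (Finset.sum_eq_zero_iff_of_nonneg fun i _ => ((hBox r).mp hr).1.1 i).mp h0
    exact hr0 (funext fun i => this i (Finset.mem_univ i))
  have hset : ∀ n : ℕ, {x | IsLexMax A x ∧ A x ∈ Λ ∧ ∑ i, x i = n} =
      ↑(((Box.filter fun r => ht r ≤ n).sigma fun r => (sp r).finsuppAntidiag (n - ht r)).image
        fun p => fun i => p.1 i + (p.2 i : ℚ)) := by
    intro n
    ext x
    simp only [Set.mem_ofPred_eq, Finset.coe_image, Set.mem_image, Finset.mem_coe, Finset.mem_sigma,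
      Finset.mem_filter, Finset.mem_finsuppAntidiag, Sigma.exists]
    constructor
    · rintro ⟨hx, hxΛ, hxn⟩
      -- Ceiling minus one, rather than floor, puts the remainder in `(0, 1]` and so preserves the
      -- support of `x`; truncated subtraction gives `0` where `x i = 0`.
      let m : ι →₀ ℕ := Finsupp.equivFunOnFinite.symm fun i => ⌈x i⌉₊ - 1
      let r : ι → ℚ := fun i => x i - m i
      have hm : ∀ i, m i = ⌈x i⌉₊ - 1 := fun i => rfl
      have hr : ∀ i, r i = x i - m i := fun i => rfl
      have hx0 : ∀ i, x i = 0 → r i = 0 := fun i h => by simp [hr, hm, h]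
      have hxpos : ∀ i, x i ≠ 0 → 0 < r i ∧ r i ≤ 1 := by
        intro i h
        have hpos : 0 < x i := lt_of_le_of_ne (hx.1 i) (Ne.symm h)
        have h1 := Nat.le_ceil (x i)
        have h2 := Nat.ceil_lt_add_one hpos.le
        have h3 : 1 ≤ ⌈x i⌉₊ := Nat.ceil_pos.mpr hpos
        rw [hr, hm, Nat.cast_sub h3]
        push_cast
        constructor <;> linarith
      have hrm : ∀ i, r i = 0 → m i = 0 := by
        intro i h
        have : x i = 0 := by
          by_contra hne
          exact (hxpos i hne).1.ne' h
        simp [hm, this]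
      have hr01 : ∀ i, 0 ≤ r i ∧ r i ≤ 1 := by
        intro i
        by_cases h : x i = 0
        · simp [hx0 i h]
        · exact ⟨(hxpos i h).1.le, (hxpos i h).2⟩
      have hrBox : r ∈ Box := by
        refine (hBox r).mpr ⟨hx.of_support_subset (fun i => (hr01 i).1) hx0, ?_,
          fun i => (hr01 i).2⟩
        rw [show r = x - fun i => (m i : ℚ) from rfl, map_sub]
        exact Λ.sub_mem hxΛ (hAnat m)
      have hsum : (n : ℚ) = ht r + ∑ i, (m i : ℚ) := by
        rw [hht r hrBox, ← Finset.sum_add_distrib, ← hxn]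
        exact Finset.sum_congr rfl fun i _ => by rw [hr]; ring
      have hsum' : n = ht r + ∑ i, m i := by exact_mod_cast hsum
      refine ⟨r, m, ⟨⟨hrBox, by omega⟩, ?_, ?_⟩, ?_⟩
      · rw [show n - ht r = ∑ i, m i by omega]
        refine Finset.sum_subset (Finset.subset_univ _) fun i _ hi => hrm i ?_
        simpa [sp] using hi
      · intro i hi
        simp only [sp, Finset.mem_filter, Finset.mem_univ, true_and]
        intro h
        exact (Finsupp.mem_support_iff.mp hi) (hrm i h)
      · funext i
        simp [hr]
    · rintro ⟨r, m, ⟨⟨hr, hn⟩, hm, hsupp⟩, rfl⟩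
      obtain ⟨h1, h2, h3⟩ := (hBox r).mp hr
      have hm0 : ∀ i, r i = 0 → m i = 0 := by
        intro i hi
        by_contra h
        have := hsupp (Finsupp.mem_support_iff.mpr h)
        simp [sp, hi] at this
      refine ⟨h1.of_support_subset (fun i => ?_) fun i hi => ?_, ?_, ?_⟩
      · exact add_nonneg (h1.1 i) (Nat.cast_nonneg _)
      · simp [hi, hm0 i hi]
      · change A (r + fun i => (m i : ℚ)) ∈ Λ
        rw [map_add]
        exact Λ.add_mem h2 (hAnat m)
      · rw [Finset.sum_add_distrib, ← hht r hr]
        have : ∑ i, m i = n - ht r := by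
          rw [← hm]
          refine (Finset.sum_subset (Finset.subset_univ _) fun i _ hi => hm0 i ?_).symm
          simpa [sp] using hi
        rw [← Nat.cast_sum, this, Nat.cast_sub hn]
        ring
  have hcard : ∀ n : ℕ, Set.ncard {x | IsLexMax A x ∧ A x ∈ Λ ∧ ∑ i, x i = n} =
      ∑ r ∈ Box, if ht r ≤ n then ((sp r).card + (n - ht r) - 1).choose (n - ht r) else 0 := by
    intro n
    rw [hset n, Set.ncard_coe_finset, Finset.card_image_of_injOn, Finset.card_sigma,
      Finset.sum_filter]
    · simp only [Finset.card_finsuppAntidiag_nat_eq_choose]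
    · rintro ⟨r, m⟩ hp ⟨r', m'⟩ hp' h
      simp only [Finset.coe_sigma, Set.mem_sigma_iff, Finset.mem_coe, Finset.mem_filter,
        Finset.mem_finsuppAntidiag] at hp hp'
      have key : ∀ (r : ι → ℚ) (m : ι →₀ ℕ), r ∈ Box → m.support ⊆ sp r →
          ∀ i, ⌈r i + m i⌉₊ - 1 = m i := by
        intro r m hr hm i
        refine ceil_add_nat_sub_one (((hBox r).mp hr).1.1 i) (((hBox r).mp hr).2.2 i) fun hi => ?_
        by_contra h
        have := hm (Finsupp.mem_support_iff.mpr h)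
        simp [sp, hi] at this
      have hm : m = m' := by
        ext i
        rw [← key r m hp.1.1 hp.2.2 i, ← key r' m' hp'.1.1 hp'.2.2 i]
        have := congrFun h i
        simp only at this
        rw [this]
      subst hm
      have hr : r = r' := by
        funext i
        simpa using congrFun h i
      subst hr
      rfl
  have h0Box : (0 : ι → ℚ) ∈ Box := (hBox 0).mpr ⟨isLexMax_zero hA, by simp, zero_le_one⟩
  have hsp0 : sp 0 = ∅ := by simp [sp]
  have hht0 : ht 0 = 0 := by simp [ht]
  -- The box vector `0` counts only the origin, at `n = 0`. Leaving it out does not affect `n ≥ 1`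
  -- and is why the empty face is missing from the Euler characteristic.
  refine ⟨∑ r ∈ Box.erase 0, preHilbertPoly ℚ ((sp r).card - 1) (ht r), ?_, ?_⟩
  · let D : Finset (Finset ι) := Finset.univ.filter fun s => IsLexMax A (indicatorVec s)
    have hD : ∀ s, s ∈ D ↔ IsLexMax A (indicatorVec s) := fun s => by simp [D]
    have h0D : ∅ ∈ D := (hD ∅).mpr (by
      rw [show indicatorVec (∅ : Finset ι) = 0 from funext fun i => by simp [indicatorVec]]
      exact isLexMax_zero hA)
    have hEuler := sum_neg_one_pow_card_isLexMax hb D hD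
    rw [← Finset.add_sum_erase _ _ h0D] at hEuler
    simp only [Finset.card_empty, pow_zero] at hEuler
    have : ∑ s ∈ D.erase ∅, (-1 : ℚ) ^ (s.card - 1) = 1 := by
      have h : ∀ s ∈ D.erase ∅, (-1 : ℚ) ^ (s.card - 1) = - (-1 : ℚ) ^ s.card := by
        intro s hs
        have : s.card - 1 + 1 = s.card :=
          Nat.sub_add_cancel (Finset.card_pos.mpr (Finset.nonempty_iff_ne_empty.mpr
            (Finset.ne_of_mem_erase hs)))
        rw [← this, pow_succ, Nat.add_sub_cancel]
        ring
      rw [Finset.sum_congr rfl h, Finset.sum_neg_distrib]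
      linarith
    rw [eval_finsetSum, ← this]
    rw [Finset.sum_congr rfl fun r hr => eval_zero_preHilbertPoly
      (hht_pos r (Finset.mem_of_mem_erase hr) (Finset.ne_of_mem_erase hr))
      (hht_le r (Finset.mem_of_mem_erase hr)), ← Finset.sum_filter]
    have hspind : ∀ s, sp (indicatorVec s) = s := fun s => by
      ext i; simp [sp, indicatorVec]
    refine Finset.sum_nbij' sp indicatorVec ?_ ?_ ?_ ?_ ?_
    · intro r hr
      simp only [Finset.mem_filter, Finset.mem_erase] at hr
      simp only [Finset.mem_erase, hD]
      constructor
      · intro h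
        apply hr.1.1
        funext i
        by_contra hi
        have : i ∈ sp r := by simpa [sp] using hi
        simp [h] at this
      · refine ((hBox r).mp hr.1.2).1.of_support_subset ?_ ?_
        · intro i
          simp only [indicatorVec, Pi.zero_apply]
          split_ifs <;> norm_num
        · intro i hi
          simp [indicatorVec, sp, hi]
    · intro s hs
      simp only [Finset.mem_erase, hD] at hs
      simp only [Finset.mem_filter, Finset.mem_erase, hBox]
      refine ⟨⟨?_, hs.2, ?_, ?_⟩, ?_⟩
      · intro h
        apply hs.1
        rw [← hspind s, h, hsp0]
      · convert hAnat (fun i => if i ∈ s then 1 else 0) using 2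
        funext i
        simp [indicatorVec]
      · intro i
        simp only [indicatorVec, Pi.one_apply]
        split_ifs <;> norm_num
      · rw [hspind]
        simp [ht, indicatorVec]
    -- Coordinates at most `1` whose sum equals the size of the support are all `1` on it.
    · intro r hr
      simp only [Finset.mem_filter, Finset.mem_erase] at hr
      have hle := ((hBox r).mp hr.1.2).2.2
      have h1 : ∑ i ∈ sp r, r i = ∑ i ∈ sp r, 1 := by
        rw [← hsum_sp, ← hht r hr.1.2, hr.2]
        simp
      have h2 := (Finset.sum_eq_sum_iff_of_le fun i _ => hle i).mp h1
      funext i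
      by_cases hi : i ∈ sp r
      · simp [indicatorVec, hi, h2 i hi]
      · have : r i = 0 := by simpa [sp] using hi
        simp [indicatorVec, hi, this]
    · intro s _
      exact hspind s
    · intro r _
      rfl
  · intro n hn
    rw [hcard, eval_finsetSum, ← Finset.add_sum_erase _ _ h0Box]
    push_cast
    rw [hsp0, hht0]
    have : (n - 0 - 1).choose (n - 0) = 0 := Nat.choose_eq_zero_of_lt (by omega)
    simp only [Finset.card_empty, zero_add, this, Nat.cast_zero, ite_self]
    refine Finset.sum_congr rfl fun r hr => ?_
    have hrB := Finset.mem_of_mem_erase hr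
    rw [eval_preHilbertPoly_natCast
      ((hht_pos r hrB (Finset.ne_of_mem_erase hr)).trans (hht_le r hrB)) (hht_le r hrB) hn]

end Counting

end MonomialIdeal

namespace MonomialIdeal

/-! ### Ehrhart polynomials of lattice polytopes -/

section Ehrhart

open scoped Pointwise

theorem mem_smul_convexHull_range {ι E : Type*} [Fintype ι] [AddCommGroup E] [Module ℚ E]
    (w : ι → E) {t : ℚ} (ht : 0 < t) (x : E) :
    x ∈ t • convexHull ℚ (Set.range w) ↔
      ∃ c : ι → ℚ, 0 ≤ c ∧ ∑ i, c i = t ∧ ∑ i, c i • w i = x := by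
  classical
  rw [Set.mem_smul_set]
  constructor
  · rintro ⟨y, hy, rfl⟩
    have h : convexHull ℚ (Set.range w) = (Fintype.linearCombination ℚ w) '' stdSimplex ℚ ι := by
      rw [← convexHull_basis_eq_stdSimplex, LinearMap.image_convexHull, ← Set.range_comp]
      congr
      funext i
      simp [Fintype.linearCombination_apply]
    rw [h] at hy
    obtain ⟨c, ⟨hc0, hc1⟩, rfl⟩ := hy
    refine ⟨t • c, fun i => mul_nonneg ht.le (hc0 i), ?_, ?_⟩
    · simp [← Finset.mul_sum, hc1]
    · simp [Fintype.linearCombination_apply, Finset.smul_sum, smul_smul]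
  · rintro ⟨c, hc0, hc1, rfl⟩
    refine ⟨∑ i, (t⁻¹ * c i) • w i, ?_, ?_⟩
    · refine (convex_convexHull ℚ _).sum_mem (fun i _ => ?_) ?_
        fun i _ => subset_convexHull ℚ _ ⟨i, rfl⟩
      · exact mul_nonneg (inv_nonneg.mpr ht.le) (hc0 i)
      · rw [← Finset.mul_sum, hc1, inv_mul_cancel₀ ht.ne']
    · simp only [Finset.smul_sum, smul_smul, mul_inv_cancel_left₀ ht.ne']

/-- The Ehrhart function of a nonempty lattice polytope agrees with a polynomial at all positive
dilation factors, and the constant term of this polynomial is `1`. -/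
theorem exists_ehrhartPolynomial {d : ℕ} {W : Set (Fin d → ℚ)} (hfin : W.Finite)
    (hne : W.Nonempty) (hint : ∀ x ∈ W, ∃ z : Fin d → ℤ, x = fun i => (z i : ℚ)) :
    ∃ P : Polynomial ℚ, P.eval 0 = 1 ∧ ∀ n : ℕ, 1 ≤ n →
      (ehrhartFunction (convexHull ℚ W) n : ℚ) = P.eval (n : ℚ) := by
  obtain ⟨m, w, rfl⟩ : ∃ (m : ℕ) (w : Fin (m + 1) → Fin d → ℚ), Set.range w = W := by
    lift W to Finset (Fin d → ℚ) using hfin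
    have hc : 0 < W.card := Finset.card_pos.mpr (by simpa using hne)
    obtain ⟨m, hm⟩ : ∃ m, W.card = m + 1 := ⟨W.card - 1, by omega⟩
    refine ⟨m, fun i => (W.equivFinOfCardEq hm).symm i, ?_⟩
    ext x
    constructor
    · rintro ⟨i, rfl⟩
      exact Subtype.coe_prop _
    · intro hx
      exact ⟨W.equivFinOfCardEq hm ⟨x, hx⟩, by simp⟩
  choose z hz using fun i => hint (w i) ⟨i, rfl⟩
  -- Homogenization: the first component records the dilation factor, so lattice points of `nP`
  -- become integral points at height `n`.
  let A : (Fin (m + 1) → ℚ) →ₗ[ℚ] ℚ × (Fin d → ℚ) :=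
    LinearMap.prod (∑ i, LinearMap.proj i) (Fintype.linearCombination ℚ w)
  have hA1 : ∀ c, (A c).1 = ∑ i, c i := fun c => by simp [A]
  have hA2 : ∀ c, (A c).2 = ∑ i, c i • w i := fun c => by
    simp [A, Fintype.linearCombination_apply]
  let φ : ℤ × (Fin d → ℤ) →+ ℚ × (Fin d → ℚ) :=
    AddMonoidHom.prodMap (Int.castAddHom ℚ) ((Int.castAddHom ℚ).compLeft (Fin d))
  have hφ1 : ∀ p, (φ p).1 = (p.1 : ℚ) := fun p => rfl
  have hφ2 : ∀ p i, (φ p).2 i = (p.2 i : ℚ) := fun p i => rfl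
  have hAker : ∀ c, A c = 0 → ∑ i, c i = 0 := fun c hc => by rw [← hA1, hc]; rfl
  obtain ⟨P, hP0, hP⟩ := exists_polynomial_ncard_isLexMax (A := A) (b := 0) (fun i => Fin.zero_le i)
    φ.range (fun i => ⟨(1, z i), by
      refine Prod.ext ?_ (funext fun j => ?_)
      · rw [hφ1, hA1]; simp
      · rw [hφ2, hA2]
        simp [Finset.sum_apply, Pi.single_apply, hz, ite_apply]⟩) hAker
    (fun c ⟨p, hp⟩ => ⟨p.1, by rw [← hA1, ← hp, hφ1]⟩) (by
      let B : Fin d → ℤ := fun j => ∑ i, |z i j|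
      refine Set.Finite.subset (((Set.finite_Icc (0 : ℤ) (m + 1)).prod (Set.finite_Icc (-B) B)).image φ) ?_
      rintro _ ⟨⟨p, hp⟩, r, hr0, hr1, rfl⟩
      refine ⟨p, ?_, hp⟩
      have h1 : (p.1 : ℚ) = ∑ i, r i := by rw [← hA1, ← hp, hφ1]
      have h2 : ∀ j, (p.2 j : ℚ) = ∑ i, r i * z i j := fun j => by
        rw [← hφ2, hp, hA2]
        simp [Finset.sum_apply, hz]
      have h3 : ∀ j, |p.2 j| ≤ B j := by
        intro j
        have : (|p.2 j| : ℚ) ≤ ∑ i, (|z i j| : ℚ) := by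
          rw [h2]
          refine (Finset.abs_sum_le_sum_abs _ _).trans (Finset.sum_le_sum fun i _ => ?_)
          rw [abs_mul, abs_of_nonneg (hr0 i)]
          exact mul_le_of_le_one_left (abs_nonneg _) (hr1 i)
        exact_mod_cast this
      refine ⟨⟨?_, ?_⟩, ⟨fun j => (abs_le.mp (h3 j)).1, fun j => (abs_le.mp (h3 j)).2⟩⟩
      · have : (0 : ℚ) ≤ p.1 := h1 ▸ Finset.sum_nonneg fun i _ => hr0 i
        exact_mod_cast this
      · have : (p.1 : ℚ) ≤ m + 1 := by
          rw [h1]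
          refine (Finset.sum_le_sum fun i _ => hr1 i).trans ?_
          simp
        exact_mod_cast this)
  refine ⟨P, hP0, fun n hn => ?_⟩
  rw [← hP n hn, ehrhartFunction]
  have hn0 : (0 : ℚ) < n := by exact_mod_cast hn
  -- Each lattice point has exactly one maximal representation. The floor only converts coordinates
  -- already known to be integral.
  have himg : {x | (fun i => ((x : Fin d → ℤ) i : ℚ)) ∈ (n : ℚ) • convexHull ℚ (Set.range w)} =
      (fun c => fun j => ⌊(A c).2 j⌋) '' {x | IsLexMax A x ∧ A x ∈ φ.range ∧ ∑ i, x i = n} := by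
    ext x
    rw [Set.mem_ofPred_eq, mem_smul_convexHull_range w hn0]
    constructor
    · rintro ⟨c, hc0, hc1, hc2⟩
      obtain ⟨y, hy, hyc⟩ := exists_isLexMax hAker c hc0
      have hyA : A y = φ (n, x) := by
        rw [hyc]
        refine Prod.ext ?_ (funext fun j => ?_)
        · rw [hφ1, hA1, hc1]; simp
        · rw [hφ2, hA2, hc2]
      refine ⟨y, ⟨hy, ⟨_, hyA.symm⟩, ?_⟩, ?_⟩
      · rw [← hA1, hyA, hφ1]; simp
      · funext j
        simp only [hyA, hφ2, Int.floor_intCast]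
    · rintro ⟨c, ⟨hc, ⟨p, hp⟩, hcn⟩, rfl⟩
      refine ⟨c, hc.1, hcn, ?_⟩
      rw [← hA2]
      funext j
      simp only [← hp, hφ2, Int.floor_intCast]
  rw [himg, Set.InjOn.ncard_image]
  rintro x ⟨hx, ⟨p, hp⟩, hxn⟩ y ⟨hy, ⟨q, hq⟩, hyn⟩ h
  refine hx.eq_of_map_eq hy (Prod.ext ?_ (funext fun j => ?_))
  · rw [hA1, hA1, hxn, hyn]
  · have := congrFun h j
    simp only [← hp, ← hq, hφ2, Int.floor_intCast] at this
    rw [← hp, ← hq, hφ2, hφ2, this]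

end Ehrhart

end MonomialIdeal

namespace MonomialIdeal

/-! ### Newton polyhedra and the easy inclusion -/

section Newton

open scoped Pointwise

variable {d : ℕ} {ι : Type*} [Fintype ι]

/-- The dilation by `t` of the Newton polyhedron of the exponent vectors `v`. -/
def newtonPolyhedron (v : ι → Fin d →₀ ℕ) (t : ℚ) : Set (Fin d → ℚ) :=
  {x | ∃ c : ι → ℚ, 0 ≤ c ∧ ∑ j, c j = t ∧ ∑ j, c j • toPoint (v j) ≤ x}

theorem toPoint_add (u w : Fin d →₀ ℕ) : toPoint (u + w) = toPoint u + toPoint w := by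
  funext i; simp [toPoint]

theorem toPoint_nsmul (n : ℕ) (u : Fin d →₀ ℕ) : toPoint (n • u) = (n : ℚ) • toPoint u := by
  funext i; simp [toPoint]

theorem toPoint_injective : Function.Injective (toPoint (d := d)) := by
  intro u w h
  ext i
  have := congrFun h i
  simp only [toPoint] at this
  exact_mod_cast this

theorem toPoint_nonneg (u : Fin d →₀ ℕ) : 0 ≤ toPoint u := fun i => Nat.cast_nonneg (u i)

theorem toPoint_mono {u w : Fin d →₀ ℕ} (h : u ≤ w) : toPoint u ≤ toPoint w :=
  fun i => Nat.cast_le.mpr (h i)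

variable {v : ι → Fin d →₀ ℕ}

theorem newtonPolyhedron_upper {t : ℚ} {x y : Fin d → ℚ} (hx : x ∈ newtonPolyhedron v t)
    (h : x ≤ y) : y ∈ newtonPolyhedron v t := by
  obtain ⟨c, h0, h1, h2⟩ := hx
  exact ⟨c, h0, h1, h2.trans h⟩

theorem newtonPolyhedron_add {s t : ℚ} {x y : Fin d → ℚ} (hx : x ∈ newtonPolyhedron v s)
    (hy : y ∈ newtonPolyhedron v t) : x + y ∈ newtonPolyhedron v (s + t) := by
  obtain ⟨c, h0, h1, h2⟩ := hx
  obtain ⟨e, k0, k1, k2⟩ := hy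
  refine ⟨c + e, add_nonneg h0 k0, ?_, ?_⟩
  · simp [Finset.sum_add_distrib, h1, k1]
  · simp only [Pi.add_apply, add_smul, Finset.sum_add_distrib]
    exact add_le_add h2 k2

theorem newtonPolyhedron_smul {r t : ℚ} (hr : 0 ≤ r) {x : Fin d → ℚ}
    (hx : x ∈ newtonPolyhedron v t) : r • x ∈ newtonPolyhedron v (r * t) := by
  obtain ⟨c, h0, h1, h2⟩ := hx
  refine ⟨r • c, smul_nonneg hr h0, ?_, ?_⟩
  · simp [← Finset.mul_sum, h1]
  · simp only [Pi.smul_apply, smul_eq_mul, mul_smul, ← Finset.smul_sum]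
    exact smul_le_smul_of_nonneg_left h2 hr

theorem convex_newtonPolyhedron (v : ι → Fin d →₀ ℕ) (t : ℚ) :
    Convex ℚ (newtonPolyhedron v t) := by
  intro x hx y hy a b ha hb hab
  have := newtonPolyhedron_add (newtonPolyhedron_smul ha hx) (newtonPolyhedron_smul hb hy)
  rwa [← add_mul, hab, one_mul] at this

theorem mem_newtonPolyhedron_zero {x : Fin d → ℚ} (hx : 0 ≤ x) : x ∈ newtonPolyhedron v 0 :=
  ⟨0, le_rfl, by simp, by simpa using hx⟩

theorem isUpperSet_newtonPolyhedron (v : ι → Fin d →₀ ℕ) (t : ℚ) :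
    IsUpperSet {u : Fin d →₀ ℕ | toPoint u ∈ newtonPolyhedron v t} :=
  fun _ _ h hu => newtonPolyhedron_upper hu (toPoint_mono h)

variable {k : Type*} [Field k]

/-- The ideal spanned by the monomials with exponents in the dilated Newton polyhedron. -/
noncomputable def newtonIdeal (k : Type*) [Field k] (v : ι → Fin d →₀ ℕ) (t : ℚ) :
    Ideal (MvPolynomial (Fin d) k) :=
  MvPolynomial.restrictSupportIdeal k {u | toPoint u ∈ newtonPolyhedron v t}
    (isUpperSet_newtonPolyhedron v t)

theorem mem_newtonIdeal {t : ℚ} {p : MvPolynomial (Fin d) k} :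
    p ∈ newtonIdeal k v t ↔ ∀ u ∈ p.support, toPoint u ∈ newtonPolyhedron v t := Iff.rfl

theorem span_monomial_pow_le_newtonIdeal (v : ι → Fin d →₀ ℕ) (n : ℕ) :
    Ideal.span (Set.range fun j => MvPolynomial.monomial (v j) (1 : k)) ^ n ≤
      newtonIdeal k v n := by
  classical
  induction n with
  | zero =>
    intro p _
    rw [mem_newtonIdeal]
    intro u _
    simpa using mem_newtonPolyhedron_zero (toPoint_nonneg u)
  | succ n ih =>
    rw [pow_succ, Ideal.mul_le]
    intro p hp s hs
    have hp' := mem_newtonIdeal.mp (ih hp)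
    rw [show (Set.range fun j => MvPolynomial.monomial (v j) (1 : k)) =
      (fun u => MvPolynomial.monomial u (1 : k)) '' Set.range v by rw [← Set.range_comp]; rfl,
      MvPolynomial.mem_ideal_span_monomial_image] at hs
    rw [mem_newtonIdeal]
    intro u hu
    obtain ⟨x, hx, y, hy, rfl⟩ := Finset.mem_add.mp (MvPolynomial.support_mul p s hu)
    obtain ⟨_, ⟨j, rfl⟩, hj⟩ := hs y hy
    rw [toPoint_add, Nat.cast_succ]
    refine newtonPolyhedron_add (hp' x hx) (newtonPolyhedron_upper ?_ (toPoint_mono hj))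
    refine ⟨Pi.single j 1, Pi.single_nonneg.mpr zero_le_one, by simp, ?_⟩
    simp [Pi.single_apply]

theorem exists_common_denominator {c : ι → ℚ} (hc : 0 ≤ c) :
    ∃ (D : ℕ) (e : ι → ℕ), 0 < D ∧ ∀ j, (e j : ℚ) = D * c j := by
  classical
  refine ⟨∏ j, (c j).den, fun j => (c j).num.toNat * ∏ i ∈ Finset.univ.erase j, (c i).den,
    Finset.prod_pos fun j _ => (c j).den_pos, fun j => ?_⟩
  rw [← Finset.mul_prod_erase _ _ (Finset.mem_univ j)]
  have h1 : (((c j).num.toNat : ℕ) : ℚ) = (c j).num := by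
    exact_mod_cast Int.toNat_of_nonneg (Rat.num_nonneg.mpr (hc j))
  have h2 := Rat.den_mul_eq_num (c j)
  push_cast
  rw [h1, ← h2]
  ring

/-- With a common denominator `D` of the coefficients, `D • u` dominates a sum of `D * n` generator
exponents, so the `D`-th power of the monomial lies in `(I ^ n) ^ D`; this is an integral equation
with only two terms. -/
theorem monomial_mem_idealClosure {n : ℕ} {u : Fin d →₀ ℕ}
    (hu : toPoint u ∈ newtonPolyhedron v n) :
    MvPolynomial.monomial u (1 : k) ∈ idealClosure
      (Ideal.span (Set.range fun j => MvPolynomial.monomial (v j) (1 : k)) ^ n) := by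
  set I := Ideal.span (Set.range fun j => MvPolynomial.monomial (v j) (1 : k)) with hI
  obtain ⟨c, hc0, hc1, hc2⟩ := hu
  obtain ⟨D, e, hD, he⟩ := exists_common_denominator hc0
  have hsum : ∑ j, e j = D * n := by
    have : (∑ j, (e j : ℚ)) = D * n := by
      rw [← hc1, Finset.mul_sum]
      exact Finset.sum_congr rfl fun j _ => he j
    exact_mod_cast this
  have hle : ∑ j, e j • v j ≤ D • u := by
    intro i
    have h : D * ∑ j, c j * (v j i : ℚ) ≤ D * (u i : ℚ) := by
      have := hc2 i
      simp only [Finset.sum_apply, Pi.smul_apply, toPoint, smul_eq_mul] at this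
      exact mul_le_mul_of_nonneg_left this (Nat.cast_nonneg D)
    rw [Finset.mul_sum] at h
    have h' : ∑ j, (e j : ℚ) * (v j i : ℚ) ≤ D * (u i : ℚ) := by
      refine le_trans (le_of_eq (Finset.sum_congr rfl fun j _ => ?_)) h
      rw [he j]; ring
    simp only [Finsupp.finsetSum_apply, Finsupp.smul_apply, smul_eq_mul]
    exact_mod_cast h'
  have hv : ∀ j, MvPolynomial.monomial (v j) (1 : k) ∈ I := fun j =>
    Ideal.subset_span (Set.mem_range_self j)
  have hmem : MvPolynomial.monomial u (1 : k) ^ D ∈ (I ^ n) ^ D := by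
    rw [MvPolynomial.monomial_pow, one_pow, ← pow_mul, mul_comm n D, ← hsum,
      ← Finset.prod_pow_eq_pow_sum]
    have h1 : MvPolynomial.monomial (∑ j, e j • v j) (1 : k) ∈ ∏ j, I ^ e j := by
      have : MvPolynomial.monomial (∑ j, e j • v j) (1 : k) =
          ∏ j, MvPolynomial.monomial (v j) (1 : k) ^ e j := by
        rw [MvPolynomial.monomial_sum_one]
        exact Finset.prod_congr rfl fun j _ => by rw [MvPolynomial.monomial_pow, one_pow]
      rw [this]
      exact Ideal.prod_mem_prod fun j _ => Ideal.pow_mem_pow (hv j) _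
    have h2 : MvPolynomial.monomial (D • u) (1 : k) =
        MvPolynomial.monomial (D • u - ∑ j, e j • v j) 1 *
          MvPolynomial.monomial (∑ j, e j • v j) 1 := by
      rw [MvPolynomial.monomial_mul, tsub_add_cancel_of_le hle, one_mul]
    rw [h2]
    exact Ideal.mul_mem_left _ _ h1
  refine ⟨Polynomial.X ^ D - Polynomial.C (MvPolynomial.monomial u (1 : k) ^ D),
    Polynomial.monic_X_pow_sub_C _ hD.ne', by simp, fun j => ?_⟩
  rw [Polynomial.natDegree_X_pow_sub_C, Polynomial.coeff_sub, Polynomial.coeff_X_pow,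
    Polynomial.coeff_C]
  rcases eq_or_ne j D with rfl | hj
  · simp
  · rcases eq_or_ne j 0 with rfl | hj0
    · simpa [hD.ne] using hmem
    · simp [hj, hj0]

theorem newtonIdeal_le_idealClosure (v : ι → Fin d →₀ ℕ) (n : ℕ) :
    newtonIdeal k v n ≤ idealClosure
      (Ideal.span (Set.range fun j => MvPolynomial.monomial (v j) (1 : k)) ^ n) := by
  intro p hp
  rw [p.as_sum]
  refine Ideal.sum_mem _ fun u hu => ?_
  rw [show MvPolynomial.monomial u (p.coeff u) =
    MvPolynomial.C (p.coeff u) * MvPolynomial.monomial u 1 by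
      rw [MvPolynomial.C_mul_monomial, mul_one]]
  exact Ideal.mul_mem_left _ _ (monomial_mem_idealClosure (mem_newtonIdeal.mp hp u hu))

/-- This says that `u` is an extreme point of the hull. If `u` were a combination of two other
points of the hull, cancelling their shares of `u` would exhibit `u` as a convex combination of
points of `K`. -/
theorem convex_convexHull_insert_diff {E : Type*} [AddCommGroup E] [Module ℚ E] {K : Set E}
    (hK : Convex ℚ K) {u : E} (hu : u ∉ K) : Convex ℚ (convexHull ℚ (insert u K) \ {u}) := by
  rcases K.eq_empty_or_nonempty with rfl | hne
  · simpa using convex_empty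
  rintro x ⟨hx, hxu⟩ y ⟨hy, hyu⟩ a b ha hb hab
  refine ⟨convex_convexHull ℚ _ hx hy ha hb hab, fun h => ?_⟩
  rw [Set.mem_singleton_iff] at h
  rw [convexHull_insert hne, hK.convexHull_eq, mem_convexJoin] at hx hy
  simp only [Set.mem_singleton_iff, exists_eq_left] at hx hy
  obtain ⟨p, hp, s, s', hs, hs', hss, rfl⟩ := hx
  obtain ⟨q, hq, t, t', ht, ht', htt, rfl⟩ := hy
  have hs0 : 0 < s' := lt_of_le_of_ne hs' fun h0 => hxu (by
    rw [← h0, add_zero] at hss; simp [← h0, hss])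
  have ht0 : 0 < t' := lt_of_le_of_ne ht' fun h0 => hyu (by
    rw [← h0, add_zero] at htt; simp [← h0, htt])
  have hpos : 0 < a * s' + b * t' := by
    rcases eq_or_lt_of_le ha with h0 | h0
    · have : b = 1 := by linarith
      rw [← h0, this]; simpa using ht0
    · have := mul_pos h0 hs0
      have := mul_nonneg hb ht0.le
      linarith
  set r := a * s' + b * t'
  have e : (a * s') • p + (b * t') • q = r • u := by
    have e1 : s = 1 - s' := by linarith
    have e2 : t = 1 - t' := by linarith
    have e3 : a = 1 - b := by linarith
    have h' : a • (s • u + s' • p) + b • (t • u + t' • q) =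
      u + (((a * s') • p + (b * t') • q) - r • u) := by
      simp only [r, e1, e2, e3]
      module
    rw [h'] at h
    exact sub_eq_zero.mp (by simpa using h)
  apply hu
  have : (a * s' / r) • p + (b * t' / r) • q = u := by
    rw [div_eq_inv_mul, div_eq_inv_mul, mul_smul r⁻¹, mul_smul r⁻¹, ← smul_add, e, smul_smul,
      inv_mul_cancel₀ hpos.ne', one_smul]
  rw [← this]
  refine hK hp hq (by positivity) (by positivity) ?_
  rw [← add_div, div_self hpos.ne']

end Newton

end MonomialIdeal

namespace MonomialIdeal

/-! ### Integral closures of powers are Newton ideals -/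

section Closure

open scoped Pointwise

variable {d : ℕ} {ι : Type*} [Fintype ι] {v : ι → Fin d →₀ ℕ} {k : Type*} [Field k]

/-- Take a smallest `B ⊆ S` that together with `K` spans `S` convexly. It is nonempty as `S ⊄ K`,
and by minimality no `u ∈ B` lies in the hull of `K` and the rest of `B`. This replaces a separating
functional. -/
theorem exists_exposed_point {E : Type*} [AddCommGroup E] [Module ℚ E]
    (S : Finset E) {K : Set E} (hK : Convex ℚ K) (hS : ¬ (S : Set E) ⊆ K) :
    ∃ u ∈ S, ∃ L : Set E, Convex ℚ L ∧ (S : Set E) ⊆ L ∧ Convex ℚ (L \ {u}) ∧ K ⊆ L \ {u} ∧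
      u ∈ L := by
  classical
  let F := S.powerset.filter fun B : Finset E => (S : Set E) ⊆ convexHull ℚ ((B : Set E) ∪ K)
  have hF : F.Nonempty := ⟨S, by
    simp only [F, Finset.mem_filter, Finset.mem_powerset, subset_refl, true_and]
    exact Set.subset_union_left.trans (subset_convexHull ℚ _)⟩
  obtain ⟨B, hB, hmin⟩ := F.exists_min_image Finset.card hF
  simp only [F, Finset.mem_filter, Finset.mem_powerset] at hB hmin
  have hne : B.Nonempty := by
    by_contra h
    rw [Finset.not_nonempty_iff_eq_empty] at h
    apply hS
    simpa [h, hK.convexHull_eq] using hB.2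
  obtain ⟨u, hu⟩ := hne
  set K' := convexHull ℚ ((B.erase u : Set E) ∪ K) with hK'
  have hK'c : Convex ℚ K' := convex_convexHull ℚ _
  have hsub : (S : Set E) ⊆ convexHull ℚ (insert u K') := by
    refine hB.2.trans (convexHull_mono ?_)
    rintro x (hx | hx)
    · rcases eq_or_ne x u with rfl | hxu
      · exact Set.mem_insert _ _
      · exact Set.mem_insert_of_mem _ (subset_convexHull ℚ _ (Or.inl (by
          simpa [hxu] using hx)))
    · exact Set.mem_insert_of_mem _ (subset_convexHull ℚ _ (Or.inr hx))
  have huK' : u ∉ K' := by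
    intro h
    rw [Set.insert_eq_of_mem h, hK'c.convexHull_eq] at hsub
    have := hmin (B.erase u) ⟨(Finset.erase_subset _ _).trans hB.1, hsub⟩
    exact absurd this (not_le.mpr (Finset.card_erase_lt_of_mem hu))
  refine ⟨u, hB.1 hu, convexHull ℚ (insert u K'), convex_convexHull ℚ _, hsub,
    convex_convexHull_insert_diff hK'c huK', fun x hx => ?_,
    subset_convexHull ℚ _ (Set.mem_insert _ _)⟩
  have hx' : x ∈ K' := subset_convexHull ℚ _ (Or.inr hx)
  exact ⟨subset_convexHull ℚ _ (Set.mem_insert_of_mem _ hx'), fun h => huK' (h ▸ hx')⟩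

theorem combo_mem_diff {E : Type*} [AddCommGroup E] [Module ℚ E] {L : Set E} {u : E}
    (hL : Convex ℚ L) (hLu : Convex ℚ (L \ {u})) {x y : E} (hx : x ∈ L \ {u}) (hy : y ∈ L)
    {a b : ℚ} (ha : 0 < a) (hb : 0 ≤ b) (hab : a + b = 1) : a • x + b • y ∈ L \ {u} := by
  by_cases hyu : y = u
  · subst hyu
    refine ⟨hL hx.1 hy ha.le hb hab, fun h => hx.2 ?_⟩
    rw [Set.mem_singleton_iff] at h ⊢
    have hb' : b = 1 - a := by linarith
    have : a • (x - y) = 0 := by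
      rw [hb'] at h
      calc a • (x - y) = a • x + (1 - a) • y - y := by module
        _ = 0 := by rw [h, sub_self]
    exact sub_eq_zero.mp ((smul_eq_zero.mp this).resolve_left ha.ne')
  · exact hLu hx ⟨hy, hyu⟩ ha.le hb hab

theorem add_mem_smul_diff {E : Type*} [AddCommGroup E] [Module ℚ E] {L : Set E} {u : E}
    (hL : Convex ℚ L) (hLu : Convex ℚ (L \ {u})) {x y : E} {a b : ℚ} (ha : 0 < a) (hb : 0 ≤ b)
    (hx : x ∈ a • (L \ {u})) (hy : y ∈ b • L) : x + y ∈ (a + b) • (L \ {u}) := by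
  obtain ⟨x, hx, rfl⟩ := hx
  obtain ⟨y, hy, rfl⟩ := hy
  have hpos : 0 < a + b := by linarith
  refine ⟨_, combo_mem_diff hL hLu hx hy (a := a / (a + b)) (b := b / (a + b)) (by positivity)
    (by positivity) (by rw [← add_div, div_self hpos.ne']), ?_⟩
  simp only [smul_add, smul_smul, mul_div_cancel₀ _ hpos.ne']

theorem support_pow_subset {L : Set (Fin d → ℚ)} (hL : Convex ℚ L) (hne : L.Nonempty)
    {p : MvPolynomial (Fin d) k} (hp : ∀ w ∈ p.support, toPoint w ∈ L) (n : ℕ) :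
    ∀ w ∈ (p ^ n).support, toPoint w ∈ (n : ℚ) • L := by
  classical
  induction n with
  | zero =>
    intro w hw
    rw [pow_zero] at hw
    have : w = 0 := by simpa using hw
    subst this
    rw [Nat.cast_zero, Set.zero_smul_set hne]
    rfl
  | succ n ih =>
    intro w hw
    rw [pow_succ] at hw
    obtain ⟨x, hx, y, hy, rfl⟩ := Finset.mem_add.mp (MvPolynomial.support_mul _ _ hw)
    rw [toPoint_add, Nat.cast_succ, hL.add_smul (Nat.cast_nonneg n) zero_le_one, one_smul]
    exact Set.add_mem_add (ih x hx) (hp y hy)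

/-- By extremality, `n • u` is a sum of `n` exponents in `L` only if each is `u`, so nothing can
cancel. -/
theorem coeff_nsmul_pow {L : Set (Fin d → ℚ)} {u : Fin d →₀ ℕ} (hL : Convex ℚ L)
    (hLu : Convex ℚ (L \ {toPoint u})) (hu : toPoint u ∈ L)
    {p : MvPolynomial (Fin d) k} (hp : ∀ w ∈ p.support, toPoint w ∈ L) (n : ℕ) :
    (p ^ n).coeff (n • u) = p.coeff u ^ n := by
  classical
  induction n with
  | zero => simp
  | succ n ih =>
    rw [pow_succ, MvPolynomial.coeff_mul, Finset.sum_eq_single (n • u, u)]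
    · rw [ih, pow_succ]
    · rintro ⟨x, y⟩ hxy hne
      rw [Finset.HasAntidiagonal.mem_antidiagonal] at hxy
      simp only at hxy ⊢
      by_contra h
      have hx := support_pow_subset hL ⟨_, hu⟩ hp n x
        (MvPolynomial.mem_support_iff.mpr (left_ne_zero_of_mul h))
      have hy := hp y (MvPolynomial.mem_support_iff.mpr (right_ne_zero_of_mul h))
      by_cases hyu : y = u
      · subst hyu
        apply hne
        rw [succ_nsmul] at hxy
        rw [add_right_cancel hxy]
      · have hy' : toPoint y ∈ (1 : ℚ) • (L \ {toPoint u}) := by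
          rw [one_smul]
          exact ⟨hy, fun h => hyu (toPoint_injective h)⟩
        have := add_mem_smul_diff hL hLu one_pos (Nat.cast_nonneg n) hy' hx
        rw [← toPoint_add, add_comm y x, hxy, toPoint_nsmul, add_comm (1 : ℚ),
          ← Nat.cast_succ, Set.smul_mem_smul_set_iff₀ (by positivity)] at this
        exact this.2 rfl
    · intro h
      exact absurd (Finset.HasAntidiagonal.mem_antidiagonal.mpr (succ_nsmul u n).symm) h

/-- The coefficient of `X ^ j` has exponents in the `(m - j)`-fold dilate of the polyhedron, hence
of `L` without `u`. Adding exponents of `p ^ j` never gives `m • u`, so only the leading term `p ^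
m` contributes there. -/
theorem idealClosure_le_newtonIdeal (v : ι → Fin d →₀ ℕ) (n : ℕ) :
    idealClosure (Ideal.span (Set.range fun j => MvPolynomial.monomial (v j) (1 : k)) ^ n) ≤
      newtonIdeal k v n := by
  classical
  rintro p ⟨f, hf, hfp, hfc⟩
  rw [mem_newtonIdeal]
  by_contra hcon
  obtain ⟨_, huS, L, hL, hSL, hLu, hKL, huL⟩ := exists_exposed_point (p.support.image toPoint)
    (convex_newtonPolyhedron v n) (fun h => hcon fun u hu => h (by
      simpa using ⟨u, by simpa using hu, rfl⟩))
  obtain ⟨u, hu, rfl⟩ := Finset.mem_image.mp huS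
  have hp : ∀ w ∈ p.support, toPoint w ∈ L := fun w hw =>
    hSL (Finset.mem_coe.mpr (Finset.mem_image_of_mem _ hw))
  set m := f.natDegree with hm
  have hm0 : 0 < m := by
    rw [Nat.pos_iff_ne_zero]
    intro h0
    rw [hf.natDegree_eq_zero.mp h0] at hfp
    simp at hfp
  rw [Polynomial.eval_eq_sum_range, Finset.sum_range_succ, hf.coeff_natDegree, one_mul] at hfp
  have hco := congrArg (MvPolynomial.coeff (m • u)) hfp
  rw [MvPolynomial.coeff_add, MvPolynomial.coeff_sum, coeff_nsmul_pow hL hLu huL hp,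
    Finset.sum_eq_zero, zero_add, MvPolynomial.coeff_zero] at hco
  · exact (MvPolynomial.mem_support_iff.mp hu) (pow_eq_zero_iff hm0.ne' |>.mp hco)
  · intro j hj
    rw [Finset.mem_range] at hj
    by_contra h
    obtain ⟨x, hx, y, hy, hxy⟩ := Finset.mem_add.mp
      (MvPolynomial.support_mul _ _ (MvPolynomial.mem_support_iff.mpr h))
    have hy' := support_pow_subset hL ⟨_, huL⟩ hp j y hy
    have hj' : (0 : ℚ) < (m - j : ℕ) := by exact_mod_cast Nat.sub_pos_of_lt hj
    have hx' : toPoint x ∈ ((m - j : ℕ) : ℚ) • (L \ {toPoint u}) := by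
      have h1 := hfc j
      rw [← pow_mul] at h1
      have h2 := mem_newtonIdeal.mp (span_monomial_pow_le_newtonIdeal v _ h1) x hx
      rw [Set.mem_smul_set_iff_inv_smul_mem₀ hj'.ne']
      apply hKL
      have h3 := newtonPolyhedron_smul (inv_nonneg.mpr hj'.le) h2
      rwa [Nat.cast_mul, mul_comm (n : ℚ), inv_mul_cancel_left₀ hj'.ne'] at h3
    have := add_mem_smul_diff hL hLu hj' (Nat.cast_nonneg j) hx' hy'
    rw [← toPoint_add, hxy, toPoint_nsmul, ← Nat.cast_add, Nat.sub_add_cancel hj.le,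
      Set.smul_mem_smul_set_iff₀ (by positivity)] at this
    exact this.2 rfl

theorem idealClosure_span_monomial_pow (v : ι → Fin d →₀ ℕ) (n : ℕ) :
    idealClosure (Ideal.span (Set.range fun j => MvPolynomial.monomial (v j) (1 : k)) ^ n) =
      newtonIdeal k v n :=
  le_antisymm (idealClosure_le_newtonIdeal v n) (newtonIdeal_le_idealClosure v n)

end Closure

/-! ### Length of a monomial quotient -/

section Length

open MvPolynomial

variable {σ : Type*} {k : Type*} [Field k]

/-- The length of `R / M` for a monomial ideal `M` is the number of monomials outside `M`. -/
theorem length_quotient_restrictSupportIdeal (C : Finset (σ →₀ ℕ)) :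
    ∀ (s : Set (σ →₀ ℕ)) (hs : IsUpperSet s), sᶜ = C →
      Module.length (MvPolynomial σ k) (MvPolynomial σ k ⧸ restrictSupportIdeal k s hs) =
        C.card := by
  classical
  induction hn : C.card generalizing C with
  | zero =>
    intro s hs hC
    rw [Finset.card_eq_zero] at hn
    subst hn
    have : restrictSupportIdeal k s hs = ⊤ := by
      rw [Finset.coe_empty, Set.compl_empty_iff] at hC
      subst hC
      exact Submodule.eq_top_iff'.mpr fun p => Set.subset_univ _
    rw [Nat.cast_zero, Module.length_eq_zero_iff, Submodule.Quotient.subsingleton_iff]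
    exact this
  | succ n ih =>
    intro s hs hC
    have hne : C.Nonempty := by
      rw [← Finset.card_pos]; omega
    -- Every proper multiple of the monomial at a maximal missing exponent lies in `M`, so its class
    -- spans a copy of the residue field in `R / M`, with quotient `R / M'`.
    obtain ⟨u, hu⟩ := C.exists_maximal hne
    have hus : u ∉ s := by
      have : u ∈ sᶜ := hC ▸ hu.1
      exact this
    have hgt : ∀ w, u < w → w ∈ s := by
      intro w hw
      by_contra h
      have : w ∈ C := by
        rw [← Finset.mem_coe, ← hC]; exact h
      exact absurd (hu.2 this hw.le) (not_le_of_gt hw)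
    have ht : IsUpperSet (insert u s) := by
      intro x y hxy hx
      rcases hx with rfl | hx
      · rcases eq_or_lt_of_le hxy with rfl | h
        · exact Set.mem_insert _ _
        · exact Set.mem_insert_of_mem _ (hgt y h)
      · exact Set.mem_insert_of_mem _ (hs hxy hx)
    have hlen := ih (C.erase u) (by rw [Finset.card_erase_of_mem hu.1, hn]; rfl) (insert u s) ht (by
      ext x
      have : x ∉ s ↔ x ∈ C := by rw [← Finset.mem_coe, ← hC]; rfl
      simp [this, and_comm])
    set M := restrictSupportIdeal k s hs with hM
    set M' := restrictSupportIdeal k (insert u s) ht with hM'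
    have memM : ∀ p, p ∈ M ↔ ∀ w, w ∉ s → coeff w p = 0 := by
      intro p
      refine ⟨fun h w hw => ?_, fun h w hw => ?_⟩
      · by_contra h0
        exact hw (h (mem_support_iff.mpr h0))
      · by_contra h0
        exact (mem_support_iff.mp hw) (h w h0)
    have memM' : ∀ p, p ∈ M' ↔ ∀ w, w ≠ u → w ∉ s → coeff w p = 0 := by
      intro p
      refine ⟨fun h w hwu hw => ?_, fun h w hw => ?_⟩
      · by_contra h0
        exact (h (mem_support_iff.mpr h0)).elim hwu hw
      · by_contra h0
        rw [Set.mem_insert_iff, not_or] at h0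
        exact (mem_support_iff.mp hw) (h w h0.1 h0.2)
    let 𝔪 : Ideal (MvPolynomial σ k) := RingHom.ker (constantCoeff (σ := σ) (R := k))
    have h𝔪 : 𝔪.IsMaximal := RingHom.ker_isMaximal_of_surjective _ fun c => ⟨MvPolynomial.C c, by simp⟩
    have hcoeff : ∀ p : MvPolynomial σ k, coeff u (p * monomial u 1) = constantCoeff p := by
      intro p
      rw [coeff_mul_monomial']
      simp [constantCoeff_eq]
    have hmemM : ∀ p : MvPolynomial σ k, p * monomial u 1 ∈ M ↔ constantCoeff p = 0 := by
      intro p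
      rw [memM]
      constructor
      · intro h
        rw [← hcoeff]
        exact h u hus
      · intro h w hw
        rcases eq_or_ne w u with rfl | hwu
        · rw [hcoeff, h]
        · rw [coeff_mul_monomial', if_neg]
          intro hle
          exact hw (hgt w (lt_of_le_of_ne hle (Ne.symm hwu)))
    let f : (MvPolynomial σ k ⧸ 𝔪) →ₗ[MvPolynomial σ k] (MvPolynomial σ k ⧸ M) :=
      Submodule.mapQ 𝔪 M (LinearMap.toSpanSingleton _ _ (monomial u 1))
        fun p hp => by
          simpa using (hmemM p).mpr hp
    let g : (MvPolynomial σ k ⧸ M) →ₗ[MvPolynomial σ k] (MvPolynomial σ k ⧸ M') :=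
      Submodule.mapQ M M' LinearMap.id fun p hp => by
        rw [Submodule.mem_comap, LinearMap.id_apply, memM']
        exact fun w _ hw => (memM p).mp hp w hw
    have hf : Function.Injective f := by
      rw [← LinearMap.ker_eq_bot, LinearMap.ker_eq_bot']
      intro x hx
      obtain ⟨p, rfl⟩ := Submodule.Quotient.mk_surjective _ x
      have : p * monomial u 1 ∈ M :=
        (Submodule.Quotient.mk_eq_zero _).mp hx
      exact (Submodule.Quotient.mk_eq_zero _).mpr ((hmemM p).mp this)
    have hg : Function.Surjective g := by
      intro x
      obtain ⟨p, rfl⟩ := Submodule.Quotient.mk_surjective _ x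
      exact ⟨Submodule.Quotient.mk p, rfl⟩
    have hfg : Function.Exact f g := by
      intro x
      obtain ⟨p, rfl⟩ := Submodule.Quotient.mk_surjective _ x
      constructor
      · intro h
        have hp : p ∈ M' := (Submodule.Quotient.mk_eq_zero _).mp h
        refine ⟨Submodule.Quotient.mk (MvPolynomial.C (coeff u p)), ?_⟩
        change Submodule.Quotient.mk (MvPolynomial.C (coeff u p) * monomial u 1) = _
        rw [Submodule.Quotient.eq, memM]
        intro w hw
        rw [C_mul_monomial, mul_one, coeff_sub, coeff_monomial]
        rcases eq_or_ne w u with rfl | hwu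
        · simp
        · simp [Ne.symm hwu, (memM' p).mp hp w hwu hw]
      · rintro ⟨y, hy⟩
        obtain ⟨r, rfl⟩ := Submodule.Quotient.mk_surjective _ y
        rw [← hy]
        change Submodule.Quotient.mk (r * monomial u 1) = _
        rw [Submodule.Quotient.mk_eq_zero, memM']
        intro w hwu hw
        rw [coeff_mul_monomial', if_neg]
        intro hle
        exact hw (hgt w (lt_of_le_of_ne hle (Ne.symm hwu)))
    have hsimple : IsSimpleModule (MvPolynomial σ k) (MvPolynomial σ k ⧸ 𝔪) :=
      isSimpleModule_iff_quot_maximal.mpr ⟨𝔪, h𝔪, ⟨LinearEquiv.refl _ _⟩⟩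
    rw [Module.length_eq_add_of_exact f g hf hg hfg, hlen, Module.length_eq_one, add_comm]
    rfl

end Length

end MonomialIdeal

namespace MonomialIdeal

/-! ### The simplex, the polytope and the Newton polyhedron -/

section Polyhedra

open scoped Pointwise

variable {d : ℕ}

/-- The linear form `⟨·, α₀⟩` with `α₀ = (1 / a₁, …, 1 / a_d)`. -/
def weight (a : Fin d → ℕ) (x : Fin d → ℚ) : ℚ := ∑ i, x i * (1 / (a i : ℚ))

theorem weight_sum_smul (a : Fin d → ℕ) {ι : Type*} [Fintype ι] (c : ι → ℚ)
    (w : ι → Fin d → ℚ) : weight a (∑ j, c j • w j) = ∑ j, c j * weight a (w j) := by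
  simp only [weight, Finset.sum_apply, Pi.smul_apply, smul_eq_mul, Finset.sum_mul, Finset.mul_sum]
  rw [Finset.sum_comm]
  exact Finset.sum_congr rfl fun j _ => Finset.sum_congr rfl fun i _ => by ring

theorem weight_mono (a : Fin d → ℕ) {x y : Fin d → ℚ} (h : x ≤ y) : weight a x ≤ weight a y :=
  Finset.sum_le_sum fun i _ => mul_le_mul_of_nonneg_right (h i) (by positivity)

theorem weight_single {a : Fin d → ℕ} (ha : ∀ i, 0 < a i) (i : Fin d) :
    weight a (toPoint (Finsupp.single i (a i))) = 1 := by
  have := (ha i).ne'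
  simp only [weight, toPoint, Finsupp.single_apply]
  rw [Finset.sum_eq_single i]
  · simp [this]
  · intro j _ hj; simp [hj.symm]
  · simp

theorem sum_smul_single {a : Fin d → ℕ} (ha : ∀ i, 0 < a i) (x : Fin d → ℚ) :
    ∑ i, (x i * (1 / (a i : ℚ))) • toPoint (Finsupp.single i (a i)) = x := by
  funext j
  have := (ha j).ne'
  simp only [Finset.sum_apply, Pi.smul_apply, toPoint, Finsupp.single_apply, smul_eq_mul]
  rw [Finset.sum_eq_single j]
  · simp [this]
  · intro i _ hi; simp [hi]
  · simp

theorem mem_smul_simplexS {a : Fin d → ℕ} (ha : ∀ i, 0 < a i) {t : ℚ} (ht : 0 < t)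
    (x : Fin d → ℚ) : x ∈ t • simplexS a ↔ 0 ≤ x ∧ weight a x ≤ t := by
  have hr : insert 0 (Set.range fun i => toPoint (Finsupp.single i (a i))) =
      Set.range (fun o : Option (Fin d) => o.elim (0 : Fin d → ℚ)
        fun i => toPoint (Finsupp.single i (a i))) := by
    ext y
    simp [Set.mem_range, Option.exists, eq_comm]
  rw [simplexS, hr, mem_smul_convexHull_range _ ht]
  simp only [Fintype.sum_option, Option.elim_none, Option.elim_some, smul_zero, zero_add]
  constructor
  · rintro ⟨c, hc0, hc1, rfl⟩
    refine ⟨Finset.sum_nonneg fun i _ => smul_nonneg (hc0 _) (toPoint_nonneg _), ?_⟩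
    rw [weight_sum_smul a (fun i => c (some i))]
    simp only [weight_single ha, mul_one]
    have := hc0 none
    simp only [Pi.zero_apply] at this
    linarith
  · rintro ⟨h0, h1⟩
    refine ⟨fun o => o.elim (t - weight a x) fun i => x i * (1 / (a i : ℚ)), ?_, ?_, ?_⟩
    · rintro (_ | i)
      · simpa using h1
      · exact mul_nonneg (h0 i) (by positivity)
    · simp [weight]
    · simpa using sum_smul_single ha x

/-- The vectors that are nonnegative combinations of the `w j` with coefficient sum `t`. -/
def coneSlice {ι : Type*} [Fintype ι] (w : ι → Fin d → ℚ) (t : ℚ) : Set (Fin d → ℚ) :=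
  {x | ∃ c : ι → ℚ, 0 ≤ c ∧ ∑ j, c j = t ∧ ∑ j, c j • w j = x}

section ConeSlice

variable {ι : Type*} [Fintype ι] {w : ι → Fin d → ℚ}

theorem coneSlice_add {s t : ℚ} {x y : Fin d → ℚ} (hx : x ∈ coneSlice w s)
    (hy : y ∈ coneSlice w t) : x + y ∈ coneSlice w (s + t) := by
  obtain ⟨c, h0, rfl, rfl⟩ := hx
  obtain ⟨e, k0, rfl, rfl⟩ := hy
  exact ⟨c + e, add_nonneg h0 k0, by simp [Finset.sum_add_distrib],
    by simp [add_smul, Finset.sum_add_distrib]⟩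

theorem coneSlice_smul {r t : ℚ} (hr : 0 ≤ r) {x : Fin d → ℚ} (hx : x ∈ coneSlice w t) :
    r • x ∈ coneSlice w (r * t) := by
  obtain ⟨c, h0, rfl, rfl⟩ := hx
  exact ⟨r • c, smul_nonneg hr h0, by simp [← Finset.mul_sum],
    by simp [mul_smul, ← Finset.smul_sum]⟩

theorem coneSlice_of_mem_Icc {r s t : ℚ} {x : Fin d → ℚ} (hr : x ∈ coneSlice w r)
    (hs : x ∈ coneSlice w s) (hrt : r ≤ t) (hts : t ≤ s) : x ∈ coneSlice w t := by
  rcases eq_or_lt_of_le (hrt.trans hts) with h | h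
  · rwa [show t = r by linarith]
  · have h' : (s - r) ≠ 0 := by linarith
    have := coneSlice_add
      (coneSlice_smul (r := (s - t) / (s - r)) (div_nonneg (by linarith) (by linarith)) hr)
      (coneSlice_smul (r := (t - r) / (s - r)) (div_nonneg (by linarith) (by linarith)) hs)
    rw [← add_smul, show (s - t) / (s - r) + (t - r) / (s - r) = 1 by field_simp; ring, one_smul,
      show (s - t) / (s - r) * r + (t - r) / (s - r) * s = t by field_simp; ring] at this
    exact this

theorem coneSlice_weight {a : Fin d → ℕ} (ha : ∀ i, 0 < a i)
    (hw : ∀ i, ∃ j, w j = toPoint (Finsupp.single i (a i))) {x : Fin d → ℚ} (hx : 0 ≤ x) :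
    x ∈ coneSlice w (weight a x) := by
  classical
  have key : ∀ s : Finset (Fin d),
      ∑ i ∈ s, (x i * (1 / (a i : ℚ))) • toPoint (Finsupp.single i (a i)) ∈
        coneSlice w (∑ i ∈ s, x i * (1 / (a i : ℚ))) := by
    intro s
    induction s using Finset.induction_on with
    | empty => exact ⟨0, le_rfl, by simp, by simp⟩
    | insert i s hi ih =>
      rw [Finset.sum_insert hi, Finset.sum_insert hi]
      refine coneSlice_add ?_ ih
      obtain ⟨j, hj⟩ := hw i
      have h1 : w j ∈ coneSlice w 1 :=
        ⟨Pi.single j 1, Pi.single_nonneg.mpr zero_le_one, by simp, by simp [Pi.single_apply]⟩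
      rw [hj] at h1
      have := coneSlice_smul (r := x i * (1 / (a i : ℚ)))
        (mul_nonneg (hx i) (by positivity)) h1
      rwa [mul_one] at this
  have := key Finset.univ
  rwa [sum_smul_single ha] at this

end ConeSlice

theorem mem_newtonPolyhedron_of_coneSlice {ι : Type*} [Fintype ι] {v : ι → Fin d →₀ ℕ} {t : ℚ}
    {x y : Fin d → ℚ} (hx : x ∈ coneSlice (fun j => toPoint (v j)) t) (hxy : x ≤ y) :
    y ∈ newtonPolyhedron v t := by
  obtain ⟨c, h0, h1, rfl⟩ := hx
  exact ⟨c, h0, h1, hxy⟩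

variable {q : ℕ} {v : Fin q → Fin d →₀ ℕ} {a : Fin d → ℕ}

/-- Using only the vertices `a_i e_i`, the vector `x` has coefficient sum `weight a x`; scaling down
to sum `t` only decreases it. -/
theorem mem_newtonPolyhedron_of_le_weight (ha : ∀ i, 0 < a i ∧ ∃ j, v j = Finsupp.single i (a i))
    {t : ℚ} (ht : 0 < t) {x : Fin d → ℚ} (hx : 0 ≤ x) (hxt : t ≤ weight a x) :
    x ∈ newtonPolyhedron v t := by
  have h1 := coneSlice_weight (w := fun j => toPoint (v j)) (fun i => (ha i).1)
    (fun i => (ha i).2.imp fun j hj => by rw [hj]) hx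
  have hpos : 0 < weight a x := ht.trans_le hxt
  have h2 := coneSlice_smul (r := t / weight a x) (by positivity) h1
  rw [div_mul_cancel₀ _ hpos.ne'] at h2
  refine mem_newtonPolyhedron_of_coneSlice h2 fun i => ?_
  simp only [Pi.smul_apply, smul_eq_mul]
  exact mul_le_of_le_one_left (hx i) ((div_le_one hpos).mpr hxt)

/-- The polytope is the intersection of the simplex with the Newton polyhedron. Generators of weight
at least `1` that are not vertices can be traded for combinations of the `a_i e_i` without lowering
the coefficient sum. -/
theorem mem_smul_polytopeP (ha : ∀ i, 0 < a i ∧ ∃ j, v j = Finsupp.single i (a i))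
    {t : ℚ} (ht : 0 < t) (x : Fin d → ℚ) :
    x ∈ t • polytopeP a v ↔ (0 ≤ x ∧ weight a x ≤ t) ∧ x ∈ newtonPolyhedron v t := by
  classical
  let p : Fin q → Prop := fun j =>
    (∃ i, v j = Finsupp.single i (a i)) ∨ ∑ i, (v j i : ℚ) * (1 / (a i : ℚ)) < 1
  let w : {j // p j} → Fin d → ℚ := fun j => toPoint (v j)
  have hr : {y | ∃ j, y = toPoint (v j) ∧ p j} = Set.range w := by
    ext y
    constructor
    · rintro ⟨j, rfl, hj⟩
      exact ⟨⟨j, hj⟩, rfl⟩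
    · rintro ⟨⟨j, hj⟩, rfl⟩
      exact ⟨j, rfl, hj⟩
  have hw : ∀ i, ∃ j, w j = toPoint (Finsupp.single i (a i)) := fun i => by
    obtain ⟨j, hj⟩ := (ha i).2
    exact ⟨⟨j, Or.inl ⟨i, hj⟩⟩, by simp [w, hj]⟩
  have hP : x ∈ t • polytopeP a v ↔ x ∈ coneSlice w t := by
    change x ∈ t • convexHull ℚ {y | ∃ j, y = toPoint (v j) ∧ p j} ↔ _
    rw [hr, mem_smul_convexHull_range w ht]
    rfl
  rw [hP]
  constructor
  · rintro ⟨c, hc0, hc1, rfl⟩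
    refine ⟨⟨Finset.sum_nonneg fun j _ => smul_nonneg (hc0 j) (toPoint_nonneg _), ?_⟩, ?_⟩
    · rw [weight_sum_smul, ← hc1]
      refine Finset.sum_le_sum fun j _ => mul_le_of_le_one_right (hc0 j) ?_
      rcases j.2 with ⟨i, hi⟩ | h
      · simp only [w, hi]
        exact (weight_single (fun i => (ha i).1) i).le
      · exact h.le
    · refine ⟨fun j => if h : p j then c ⟨j, h⟩ else 0, fun j => ?_, ?_, ?_⟩
      · dsimp only
        split_ifs
        · exact hc0 _
        · exact le_rfl
      · rw [← hc1, ← Fintype.sum_subtype_add_sum_subtype p]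
        simp +contextual [Subtype.prop, Finset.sum_eq_zero_iff_of_nonneg]
      · rw [← Fintype.sum_subtype_add_sum_subtype p]
        refine le_of_eq ?_
        simp +contextual [Subtype.prop, w]
        exact Finset.sum_eq_zero fun j _ => dif_neg j.2
  · rintro ⟨⟨hx0, hxt⟩, c, hc0, hc1, hcx⟩
    rw [← Fintype.sum_subtype_add_sum_subtype p] at hc1 hcx
    set y := ∑ j : {j // p j}, c j • toPoint (v j) with hy
    set y' := ∑ j : {j // ¬ p j}, c j • toPoint (v j) with hy'
    have hyS : y ∈ coneSlice w (∑ j : {j // p j}, c j) := ⟨fun j => c j, fun j => hc0 _, rfl, rfl⟩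
    have hz : y' ≤ x - y := by
      intro i
      have := hcx i
      simp only [Pi.add_apply, Pi.sub_apply] at this ⊢
      linarith
    have hy'0 : 0 ≤ y' := Finset.sum_nonneg fun j _ => smul_nonneg (hc0 _) (toPoint_nonneg _)
    have hzS := coneSlice_weight (w := w) (fun i => (ha i).1) hw (hy'0.trans hz)
    have h1 := coneSlice_add hyS hzS
    rw [add_sub_cancel] at h1
    -- Now `x` has one representation with coefficient sum `weight a x ≤ t` and another with sum at
    -- least `t`; a convex combination of the two has sum exactly `t`.
    refine coneSlice_of_mem_Icc (coneSlice_weight (fun i => (ha i).1) hw hx0) h1 hxt ?_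
    rw [← hc1]
    have h2 : ∑ j : {j // ¬ p j}, c j ≤ weight a y' := by
      rw [hy', weight_sum_smul a (fun j : {j // ¬ p j} => c j)]
      refine Finset.sum_le_sum fun j _ => le_mul_of_one_le_right (hc0 _) ?_
      have := j.2
      simp only [p, not_or, not_lt] at this
      exact this.2
    have := h2.trans (weight_mono a hz)
    linarith

theorem ehrhartFunction_eq_ncard {P : Set (Fin d → ℚ)} {n : ℕ}
    (hP : ∀ x ∈ (n : ℚ) • P, 0 ≤ x) :
    ehrhartFunction P n = Set.ncard {u : Fin d →₀ ℕ | toPoint u ∈ (n : ℚ) • P} := by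
  rw [ehrhartFunction]
  have : {z : Fin d → ℤ | (fun i => (z i : ℚ)) ∈ (n : ℚ) • P} =
      (fun (u : Fin d →₀ ℕ) (i : Fin d) => (u i : ℤ)) '' {u | toPoint u ∈ (n : ℚ) • P} := by
    ext z
    constructor
    · intro hz
      have hz0 : ∀ i, 0 ≤ z i := fun i => by
        have := hP _ hz i
        simp only [Pi.zero_apply] at this
        exact_mod_cast this
      have e : ∀ i, ((z i).toNat : ℤ) = z i := fun i => Int.toNat_of_nonneg (hz0 i)
      refine ⟨Finsupp.equivFunOnFinite.symm fun i => (z i).toNat, ?_, funext fun i => e i⟩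
      have : toPoint (Finsupp.equivFunOnFinite.symm fun i => (z i).toNat) =
          fun i => (z i : ℚ) := by
        funext i
        change (((z i).toNat : ℕ) : ℚ) = z i
        exact_mod_cast congrArg (Int.cast : ℤ → ℚ) (e i)
      rw [Set.mem_ofPred_eq, this]
      exact hz
    · rintro ⟨u, hu, rfl⟩
      change (fun i => (((u i : ℕ) : ℤ) : ℚ)) ∈ (n : ℚ) • P
      simp only [Int.cast_natCast]
      exact hu
  rw [this, Set.InjOn.ncard_image]
  intro u _ w _ h
  ext i
  exact Nat.cast_injective (R := ℤ) (congrFun h i)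

theorem finite_weight_le (ha : ∀ i, 0 < a i) (n : ℕ) :
    {u : Fin d →₀ ℕ | weight a (toPoint u) ≤ n}.Finite := by
  refine (Set.finite_Iic (Finsupp.equivFunOnFinite.symm fun i => n * a i : Fin d →₀ ℕ)).subset ?_
  intro u hu i
  have hpos : (0 : ℚ) < a i := by exact_mod_cast ha i
  have h1 : (u i : ℚ) * (1 / (a i : ℚ)) ≤ weight a (toPoint u) :=
    Finset.single_le_sum (f := fun i => toPoint u i * (1 / (a i : ℚ)))
      (fun j _ => mul_nonneg (toPoint_nonneg u j) (by positivity)) (Finset.mem_univ i)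
  have h2 := h1.trans hu
  rw [mul_one_div, div_le_iff₀ hpos] at h2
  change u i ≤ n * a i
  exact_mod_cast h2

theorem compl_newton_subset (ha : ∀ i, 0 < a i ∧ ∃ j, v j = Finsupp.single i (a i)) (n : ℕ) :
    {u : Fin d →₀ ℕ | toPoint u ∉ newtonPolyhedron v n} ⊆ {u | weight a (toPoint u) < n} := by
  intro u hu
  by_contra h
  rw [Set.mem_ofPred_eq, not_lt] at h
  apply hu
  rcases Nat.eq_zero_or_pos n with rfl | hn
  · simpa using mem_newtonPolyhedron_zero (toPoint_nonneg u)
  · exact mem_newtonPolyhedron_of_le_weight ha (by exact_mod_cast hn) (toPoint_nonneg u) h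

theorem finite_compl_newton (ha : ∀ i, 0 < a i ∧ ∃ j, v j = Finsupp.single i (a i)) (n : ℕ) :
    {u : Fin d →₀ ℕ | toPoint u ∉ newtonPolyhedron v n}.Finite :=
  (finite_weight_le (fun i => (ha i).1) n).subset fun u hu =>
    le_of_lt (a := weight a (toPoint u)) (compl_newton_subset ha n hu)

theorem ncard_compl_newton_add (ha : ∀ i, 0 < a i ∧ ∃ j, v j = Finsupp.single i (a i)) {n : ℕ}
    (hn : 1 ≤ n) :
    Set.ncard {u : Fin d →₀ ℕ | toPoint u ∉ newtonPolyhedron v n} +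
      ehrhartFunction (polytopeP a v) n = ehrhartFunction (simplexS a) n := by
  have hn0 : (0 : ℚ) < n := by exact_mod_cast hn
  rw [ehrhartFunction_eq_ncard fun x hx => ((mem_smul_polytopeP ha hn0 x).mp hx).1.1,
    ehrhartFunction_eq_ncard fun x hx => ((mem_smul_simplexS (fun i => (ha i).1) hn0 x).mp hx).1]
  simp only [mem_smul_polytopeP ha hn0, mem_smul_simplexS (fun i => (ha i).1) hn0, toPoint_nonneg,
    true_and]
  have hfin := finite_weight_le (fun i => (ha i).1) n
  rw [← Set.ncard_union_eq ?_ (finite_compl_newton ha n) (hfin.subset fun u hu => hu.1)]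
  · congr 1
    ext u
    have h : toPoint u ∉ newtonPolyhedron v n → weight a (toPoint u) ≤ n := fun h =>
      (compl_newton_subset ha n h : weight a _ < n).le
    simp only [Set.mem_union, Set.mem_ofPred_eq]
    tauto
  · rw [Set.disjoint_left]
    exact fun u h1 h2 => h1 h2.2

theorem ncard_compl_newton_le (ha : ∀ i, 0 < a i ∧ ∃ j, v j = Finsupp.single i (a i)) (n : ℕ) :
    Set.ncard {u : Fin d →₀ ℕ | toPoint u ∉ newtonPolyhedron v n} ≤ n ^ d * ∏ i, a i := by
  classical
  have hsub : (fun (u : Fin d →₀ ℕ) (i : Fin d) => u i) ''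
      {u : Fin d →₀ ℕ | toPoint u ∉ newtonPolyhedron v n} ⊆
      ↑(Fintype.piFinset fun i => Finset.range (n * a i)) := by
    rintro _ ⟨u, hu, rfl⟩
    rw [Finset.mem_coe, Fintype.mem_piFinset]
    intro i
    have hpos : (0 : ℚ) < a i := by exact_mod_cast (ha i).1
    have h1 : (u i : ℚ) * (1 / (a i : ℚ)) ≤ weight a (toPoint u) :=
      Finset.single_le_sum (f := fun i => toPoint u i * (1 / (a i : ℚ)))
        (fun j _ => mul_nonneg (toPoint_nonneg u j) (by positivity)) (Finset.mem_univ i)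
    have h2 := h1.trans_lt (compl_newton_subset ha n hu)
    rw [mul_one_div, div_lt_iff₀ hpos] at h2
    rw [Finset.mem_range]
    exact_mod_cast h2
  have hinj : Function.Injective fun (u : Fin d →₀ ℕ) (i : Fin d) => u i := DFunLike.coe_injective
  rw [← Set.ncard_image_of_injective _ hinj]
  refine (Set.ncard_le_ncard hsub (Finset.finite_toSet _)).trans (le_of_eq ?_)
  rw [Set.ncard_coe_finset, Fintype.card_piFinset]
  simp [Finset.prod_mul_distrib]

/-- Points of the `d * m`-th dilate have total degree at least `d * m`, since each generator has
degree at least `1`; the cube `[0, m)^d` stays strictly below. -/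
theorem le_ncard_compl_newton (ha : ∀ i, 0 < a i ∧ ∃ j, v j = Finsupp.single i (a i))
    (hv : ∀ j, v j ≠ 0) (hd : 0 < d) (m : ℕ) :
    m ^ d ≤ Set.ncard {u : Fin d →₀ ℕ | toPoint u ∉ newtonPolyhedron v (d * m : ℕ)} := by
  classical
  have hsub : (Finsupp.equivFunOnFinite.symm '' ↑(Fintype.piFinset fun _ : Fin d =>
      Finset.range m) : Set (Fin d →₀ ℕ)) ⊆
      {u : Fin d →₀ ℕ | toPoint u ∉ newtonPolyhedron v (d * m : ℕ)} := by
    rintro _ ⟨f, hf, rfl⟩ ⟨c, hc0, hc1, hc2⟩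
    rw [Finset.mem_coe, Fintype.mem_piFinset] at hf
    have h1 : ∑ i, f i < d * m := by
      calc ∑ i, f i < ∑ _i : Fin d, m := by
            have : Nonempty (Fin d) := ⟨⟨0, hd⟩⟩
            exact Finset.sum_lt_sum_of_nonempty Finset.univ_nonempty
              fun i _ => Finset.mem_range.mp (hf i)
        _ = d * m := by simp
    have h2 : ∑ i, ∑ j, c j * (v j i : ℚ) ≤ ∑ i, (f i : ℚ) := by
      refine Finset.sum_le_sum fun i _ => ?_
      have := hc2 i
      simpa [Finset.sum_apply, toPoint] using this
    rw [Finset.sum_comm] at h2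
    have h3 : ∑ j, c j ≤ ∑ j, ∑ i, c j * (v j i : ℚ) := by
      refine Finset.sum_le_sum fun j _ => ?_
      rw [← Finset.mul_sum]
      refine le_mul_of_one_le_right (hc0 j) ?_
      obtain ⟨i, hi⟩ := Finsupp.ne_iff.mp (hv j)
      have : 1 ≤ ∑ i, v j i := (Nat.one_le_iff_ne_zero.mpr hi).trans
        (Finset.single_le_sum (f := fun i => v j i) (fun _ _ => Nat.zero_le _) (Finset.mem_univ i))
      exact_mod_cast this
    rw [hc1] at h3
    have h4 : ((d * m : ℕ) : ℚ) ≤ ((∑ i, f i : ℕ) : ℚ) := by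
      rw [Nat.cast_sum]; exact h3.trans h2
    exact absurd (Nat.cast_le.mp h4) (not_le.mpr h1)
  refine le_trans (le_of_eq ?_) (Set.ncard_le_ncard hsub (finite_compl_newton ha _))
  rw [Set.ncard_image_of_injective _ Finsupp.equivFunOnFinite.symm.injective,
    Set.ncard_coe_finset, Fintype.card_piFinset]
  simp

end Polyhedra

end MonomialIdeal

/-! ### Pure powers, growth and the final assembly -/

namespace MonomialIdeal

/-- Otherwise setting all variables but `x_i` to zero kills every generator, and the quotient
surjects onto a polynomial ring in one variable, of dimension `1`. -/
theorem exists_pure_power {k : Type*} [Field k] {d q : ℕ} {v : Fin q → Fin d →₀ ℕ}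
    (hdim : ringKrullDim (MvPolynomial (Fin d) k ⧸
      Ideal.span (Set.range fun j => MvPolynomial.monomial (v j) (1 : k))) = 0)
    (hv : ∀ j, v j ≠ 0) (i : Fin d) : ∃ m, 0 < m ∧ ∃ j, v j = Finsupp.single i m := by
  by_contra hcon
  push Not at hcon
  let φ : MvPolynomial (Fin d) k →ₐ[k] Polynomial k :=
    MvPolynomial.aeval fun l => if l = i then Polynomial.X else 0
  have hφ : Function.Surjective φ := by
    intro p
    refine ⟨Polynomial.aeval (MvPolynomial.X i) p, ?_⟩
    rw [← Polynomial.aeval_algHom_apply]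
    simp [φ]
  have hker : ∀ x ∈ Ideal.span (Set.range fun j => MvPolynomial.monomial (v j) (1 : k)),
      (φ : MvPolynomial (Fin d) k →+* Polynomial k) x = 0 := by
    intro x hx
    rw [← RingHom.mem_ker]
    refine (Ideal.span_le.mpr ?_) hx
    rintro _ ⟨j, rfl⟩
    have : ∃ l, l ≠ i ∧ v j l ≠ 0 := by
      by_contra h
      push Not at h
      have hs : v j = Finsupp.single i (v j i) := by
        ext l
        rcases eq_or_ne l i with rfl | hl
        · simp
        · simp [hl, h l hl]
      refine hcon (v j i) (Nat.pos_of_ne_zero fun h0 => hv j ?_) j hs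
      rw [hs, h0, Finsupp.single_zero]
    obtain ⟨l, hl, hl0⟩ := this
    rw [SetLike.mem_coe, RingHom.mem_ker]
    change φ (MvPolynomial.monomial (v j) 1) = 0
    simp only [φ, MvPolynomial.aeval_monomial, map_one, one_mul]
    exact Finset.prod_eq_zero (Finsupp.mem_support_iff.mpr hl0) (by simp [hl, hl0])
  have h1 := ringKrullDim_le_of_surjective (Ideal.Quotient.lift _ _ hker)
    (Ideal.Quotient.lift_surjective_of_surjective _ hker hφ)
  rw [hdim, Polynomial.ringKrullDim_of_isNoetherianRing, ringKrullDim_eq_zero_of_field,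
    zero_add] at h1
  exact absurd h1 (by norm_num)

theorem IsMinimallyGeneratedBy.eq_of_le {k : Type*} [Field k] {d q : ℕ}
    {I : Ideal (MvPolynomial (Fin d) k)} {v : Fin q → Fin d →₀ ℕ}
    (hv : IsMinimallyGeneratedBy I v) {j l : Fin q} (h : v j ≤ v l) : j = l := by
  by_contra hne
  apply hv.2 l
  have e : MvPolynomial.monomial (v l) (1 : k) =
      MvPolynomial.monomial (v l - v j) 1 * MvPolynomial.monomial (v j) 1 := by
    rw [MvPolynomial.monomial_mul, tsub_add_cancel_of_le h, one_mul]
  rw [e]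
  exact Ideal.mul_mem_left _ _ (Ideal.subset_span ⟨j, hne, rfl⟩)

/-- A smaller degree contradicts the lower bound along multiples of `d`, a larger one the upper
bound. -/
theorem natDegree_eq_of_growth {c : Polynomial ℚ} {d : ℕ} (hd : 0 < d) {B : ℚ}
    (hle : ∀ n : ℕ, c.eval (n : ℚ) ≤ B * (n : ℚ) ^ d) (h0 : ∀ n : ℕ, 0 ≤ c.eval (n : ℚ))
    (hge : ∀ m : ℕ, (m : ℚ) ^ d ≤ c.eval ((d * m : ℕ) : ℚ)) : c.natDegree = d := by
  have hX : (Polynomial.X ^ d : Polynomial ℚ).degree = d := Polynomial.degree_X_pow d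
  rcases lt_trichotomy c.degree (Polynomial.X ^ d : Polynomial ℚ).degree with h | h | h
  · exfalso
    have ht := Polynomial.div_tendsto_atTop_zero_of_degree_lt c (Polynomial.X ^ d) h
    have hmul : Filter.Tendsto (fun m : ℕ => ((d * m : ℕ) : ℚ)) Filter.atTop Filter.atTop :=
      tendsto_natCast_atTop_atTop.comp (Filter.tendsto_id.const_mul_atTop' hd)
    have hd' : (0 : ℚ) < 1 / (d : ℚ) ^ d := by positivity
    have hev := (ht.comp hmul).eventually (gt_mem_nhds hd')
    obtain ⟨m, hm, hm0⟩ := (hev.and (Filter.eventually_gt_atTop 0)).exists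
    have hm' : (0 : ℚ) < m := by exact_mod_cast hm0
    have hdq : (0 : ℚ) < d := by exact_mod_cast hd
    simp only [Function.comp, Polynomial.eval_pow, Polynomial.eval_X] at hm
    rw [div_lt_div_iff₀ (by positivity) (by positivity), Nat.cast_mul, mul_pow] at hm
    have := hge m
    rw [Nat.cast_mul] at this
    have h2 : (0 : ℚ) < (d : ℚ) ^ d := by positivity
    nlinarith
  · exact Polynomial.natDegree_eq_of_degree_eq_some (h.trans hX)
  · exfalso
    have ht := Polynomial.abs_div_tendsto_atTop_atTop_of_degree_gt c (Polynomial.X ^ d) h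
      (pow_ne_zero _ Polynomial.X_ne_zero)
    have hev := (ht.comp (tendsto_natCast_atTop_atTop (R := ℚ))).eventually_gt_atTop B
    obtain ⟨n, hn, hn0⟩ := (hev.and (Filter.eventually_gt_atTop 0)).exists
    have hn' : (0 : ℚ) < n := by exact_mod_cast hn0
    simp only [Function.comp, Polynomial.eval_pow, Polynomial.eval_X] at hn
    rw [abs_of_nonneg (div_nonneg (h0 n) (by positivity)), lt_div_iff₀ (by positivity)] at hn
    exact absurd (hle n) (not_le.mpr hn)

theorem hilbertFunction_span_monomial {k : Type*} [Field k] {d q : ℕ} {v : Fin q → Fin d →₀ ℕ}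
    {a : Fin d → ℕ} (ha : ∀ i, 0 < a i ∧ ∃ j, v j = Finsupp.single i (a i)) (n : ℕ) :
    hilbertFunction (Ideal.span (Set.range fun j => MvPolynomial.monomial (v j) (1 : k))) n =
      Set.ncard {u : Fin d →₀ ℕ | toPoint u ∉ newtonPolyhedron v n} := by
  have hfin := finite_compl_newton ha n
  rw [hilbertFunction, idealClosure_span_monomial_pow, Set.ncard_eq_toFinset_card _ hfin]
  exact length_quotient_restrictSupportIdeal hfin.toFinset _ (isUpperSet_newtonPolyhedron v n)
    (by rw [Set.Finite.coe_toFinset]; rfl)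

theorem exists_ehrhartPolynomial_simplexS {d : ℕ} (a : Fin d → ℕ) :
    ∃ P : Polynomial ℚ, P.eval 0 = 1 ∧ ∀ n : ℕ, 1 ≤ n →
      (ehrhartFunction (simplexS a) n : ℚ) = P.eval (n : ℚ) := by
  refine exists_ehrhartPolynomial ((Set.finite_range _).insert 0) (Set.insert_nonempty _ _) ?_
  rintro x (rfl | ⟨i, rfl⟩)
  · exact ⟨0, by funext i; simp⟩
  · exact ⟨fun l => (Finsupp.single i (a i) l : ℕ), by funext l; simp [toPoint]⟩

theorem exists_ehrhartPolynomial_polytopeP {d q : ℕ} (hd : 0 < d) {a : Fin d → ℕ}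
    {v : Fin q → Fin d →₀ ℕ} (ha : ∀ i, ∃ j, v j = Finsupp.single i (a i)) :
    ∃ P : Polynomial ℚ, P.eval 0 = 1 ∧ ∀ n : ℕ, 1 ≤ n →
      (ehrhartFunction (polytopeP a v) n : ℚ) = P.eval (n : ℚ) := by
  refine exists_ehrhartPolynomial ?_ ?_ ?_
  · refine (Set.finite_range fun j => toPoint (v j)).subset ?_
    rintro x ⟨j, rfl, -⟩
    exact ⟨j, rfl⟩
  · obtain ⟨j, hj⟩ := ha ⟨0, hd⟩
    exact ⟨_, j, rfl, Or.inl ⟨_, hj⟩⟩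
  · rintro x ⟨j, rfl, -⟩
    exact ⟨fun l => (v j l : ℕ), by funext l; simp [toPoint]⟩

end MonomialIdeal

theorem proposition3p5 {k : Type*} [Field k] (d : ℕ) (hd : 2 ≤ d)
    (I : Ideal (MvPolynomial (Fin d) k)) (hdim : ringKrullDim (MvPolynomial (Fin d) k ⧸ I) = 0)
    (q : ℕ) (v : Fin q → Fin d →₀ ℕ) (hv : MonomialIdeal.IsMinimallyGeneratedBy I v) :
    -- for each `i` exactly one generator is a pure power `x_i ^ (a i)`, and `a i > 0`
    ∃ a : Fin d → ℕ,
      (∀ i, 0 < a i ∧ ∃ j, v j = Finsupp.single i (a i)) ∧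
      (∀ i m, (∃ j, v j = Finsupp.single i m) → m = a i) ∧
      -- the Hilbert function takes finite values `f n`
      ∃ f : ℕ → ℕ, (∀ n, MonomialIdeal.hilbertFunction I n = f n) ∧
        (∃ ES EP : Polynomial ℚ,
          MonomialIdeal.IsEhrhartPolynomial (MonomialIdeal.simplexS a) ES ∧
          MonomialIdeal.IsEhrhartPolynomial (MonomialIdeal.polytopeP a v) EP ∧
          ∀ n : ℕ, (f n : ℚ) = ES.eval (n : ℚ) - EP.eval (n : ℚ)) ∧
        ∃ c : Polynomial ℚ, c.natDegree = d ∧ c.coeff 0 = 0 ∧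
          ∀ n : ℕ, (f n : ℚ) = c.eval (n : ℚ) := by
  -- A generator `1` would make the quotient zero, whose Krull dimension is `⊥` and not `0`.
  have hv0 : ∀ j, v j ≠ 0 := by
    intro j hj
    have hI : I = ⊤ := by
      rw [Ideal.eq_top_iff_one, hv.1]
      exact Ideal.subset_span ⟨j, by simp [hj]⟩
    have : Subsingleton (MvPolynomial (Fin d) k ⧸ I) := Ideal.Quotient.subsingleton_iff.mpr hI
    rw [ringKrullDim_eq_bot_of_subsingleton] at hdim
    exact absurd hdim (by simp)
  have hdim' := hdim
  rw [hv.1] at hdim'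
  choose a ha using MonomialIdeal.exists_pure_power hdim' hv0
  have hd0 : 0 < d := by omega
  obtain ⟨ES, hES0, hES⟩ := MonomialIdeal.exists_ehrhartPolynomial_simplexS a
  obtain ⟨EP, hEP0, hEP⟩ :=
    MonomialIdeal.exists_ehrhartPolynomial_polytopeP hd0 fun i => (ha i).2
  let f : ℕ → ℕ := fun n =>
    Set.ncard {u : Fin d →₀ ℕ | MonomialIdeal.toPoint u ∉ MonomialIdeal.newtonPolyhedron v n}
  have hf0 : f 0 = 0 := Nat.eq_zero_of_le_zero
    ((MonomialIdeal.ncard_compl_newton_le ha 0).trans (by simp [hd0.ne']))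
  have hf : ∀ n : ℕ, (f n : ℚ) = ES.eval (n : ℚ) - EP.eval (n : ℚ) := by
    intro n
    rcases Nat.eq_zero_or_pos n with rfl | hn
    · rw [hf0, Nat.cast_zero, hES0, hEP0, sub_self]
    · rw [← hES n hn, ← hEP n hn, ← MonomialIdeal.ncard_compl_newton_add ha hn]
      push_cast
      ring
  have hc : ∀ n : ℕ, (f n : ℚ) = (ES - EP).eval (n : ℚ) := fun n => by
    rw [Polynomial.eval_sub, hf]
  refine ⟨a, ha, ?_, f, ?_, ⟨ES, EP, ?_, ?_, hf⟩, ES - EP, ?_, ?_, hc⟩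
  · rintro i m ⟨j, hj⟩
    obtain ⟨-, l, hl⟩ := ha i
    -- Two powers of one variable are comparable under divisibility, and minimal generators are not.
    have : j = l := by
      rcases le_total m (a i) with h | h
      · exact hv.eq_of_le (by rw [hj, hl]; exact Finsupp.single_le_single.mpr h)
      · exact (hv.eq_of_le (by rw [hj, hl]; exact Finsupp.single_le_single.mpr h)).symm
    subst this
    rw [hj] at hl
    exact Finsupp.single_injective i hl
  · intro n
    rw [hv.1]
    exact MonomialIdeal.hilbertFunction_span_monomial ha n
  · filter_upwards [Filter.eventually_ge_atTop 1] with n hn using hES n hn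
  · filter_upwards [Filter.eventually_ge_atTop 1] with n hn using hEP n hn
  · refine MonomialIdeal.natDegree_eq_of_growth hd0 (B := ∏ i, (a i : ℚ)) (fun n => ?_)
      (fun n => ?_) fun m => ?_
    · rw [← hc, mul_comm]
      exact_mod_cast MonomialIdeal.ncard_compl_newton_le ha n
    · rw [← hc]
      exact Nat.cast_nonneg _
    · rw [← hc]
      exact_mod_cast MonomialIdeal.le_ncard_compl_newton ha hv0 hd0 m
  · rw [Polynomial.coeff_zero_eq_eval_zero, Polynomial.eval_sub, hES0, hEP0, sub_self]
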